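/- Let $d,n,k$ be natural numbers and $0<\sigma_{\min}<\sigma_{\max}$, and let $\Theta\subset[0,\infty)^d$ with $[\sigma_{\min}^2,\sigma_{\max}^2]^d\subset\Theta$. For $\theta\in\Theta$ let $X_1,\dots,X_n$ be i.i.d. with law $\mathcal N(0,\mathrm{diag}(\theta_1,\dots,\theta_d))$ on $\mathbb R^d$. Node $i\in[n]$ observes only $X_i$ and communicates $k$ bits to a central processor, by a protocol of one of the following three types, all of which may use private randomization and are known in advance. (1) Independent: node $i$ sends $M_i\in[2^k]$ with conditional probabilities $p_i(m\mid X_i)$; given $X_1,\dots,X_n$ the messages are independent. The transcript is $Y=(M_1,\dots,M_n)$. (2) Sequential: for $i=1,\dots,n$ in turn, node $i$ sends $M_i\in[2^k]$ with conditional probabilities $p_i(m\mid X_i;M_1,\dots,M_{i-1})$. The transcript is $Y=(M_1,\dots,M_n)$. (3) Blackboard: the protocol is a complete binary tree of depth $nk$; each internal vertex $v$ carries a deterministic label $l_v\in[n]$ and a measurable function $b_v:\mathbb R^d\to[0,1]$, and every path from the root to a leaf visits, for each $i\in[n]$, exactly $k$ internal vertices with label $i$. At the vertex $v$, node $l_v$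 writes the bit $1$ with conditional probability $b_v(X_{l_v})$ and the bit $0$ otherwise, and the protocol moves along the corresponding edge. The transcript $Y\in\{0,1\}^{nk}$ is the sequence of bits written. An estimator is any function $\hat\theta=\hat\theta(Y)\in\mathbb R^d$ of the transcript. Claim: there is a universal constant $C>0$, independent of $n,k,d,\sigma_{\min},\sigma_{\max}$ and $\Theta$, such that whenever $$n\,(\sigma_{\max}^2-\sigma_{\min}^2)^2\,\min\{k^2,d\}\ \ge\ d\,\sigma_{\min}^4,$$ every protocol of type (1), (2) or (3) and every estimator $\hat\theta$ satisfy $$\sup_{\theta\in\Theta}\mathbb E_\theta\|\hat\theta-\theta\|_2^2\ \ge\ C\,\sigma_{\min}^4\,\max\left\{\frac{d^2}{nk^2},\frac dn\right\}$$ (with $\|\cdot\|_2$ the Euclidean norm; a fraction with zero denominator, which can only occur when $d=0$, is read as $0$). -/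

import Mathlib

open MeasureTheory ProbabilityTheory
open scoped ENNReal

noncomputable section

namespace DistributedEstimation

/-- The history `(y₀, …, y_{j-1})` seen before position `j` of a finite sequence `y`. -/
def history {A : Type*} {N : ℕ} (y : Fin N → A) (j : Fin N) : Fin (j : ℕ) → A :=
  fun t => y (Fin.castLE j.isLt.le t)

/-- A possibly randomized `k`-bit quantization strategy on `X`, given by the conditional
probabilities `prob x m = p(m | x)` for `m ∈ [2 ^ k]`. -/
structure Quantizer (X : Type*) [MeasurableSpace X] (k : ℕ) where
  prob : X → Fin (2 ^ k) → ℝ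
  measurable_prob : ∀ m, Measurable fun x => prob x m
  prob_nonneg : ∀ x m, 0 ≤ prob x m
  sum_prob : ∀ x, ∑ m, prob x m = 1

/-- Independent protocols: node `i` encodes its own sample with a strategy `q i`. -/
structure IndependentProtocol (X : Type*) [MeasurableSpace X] (n k : ℕ) where
  q : Fin n → Quantizer X k

/-- Conditional probability of the messages `m = (m₁, …, mₙ)` given the samples `x`. -/
def IndependentProtocol.transcriptProb {X : Type*} [MeasurableSpace X] {n k : ℕ}
    (P : IndependentProtocol X n k) (x : Fin n → X) (m : Fin n → Fin (2 ^ k)) : ℝ :=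
  ∏ i, (P.q i).prob (x i) (m i)

/-- Sequential protocols: the strategy of node `i` may depend on the previous messages. -/
structure SequentialProtocol (X : Type*) [MeasurableSpace X] (n k : ℕ) where
  q : (i : Fin n) → (Fin (i : ℕ) → Fin (2 ^ k)) → Quantizer X k

/-- Conditional probability of the messages `m = (m₁, …, mₙ)` given the samples `x`. -/
def SequentialProtocol.transcriptProb {X : Type*} [MeasurableSpace X] {n k : ℕ}
    (P : SequentialProtocol X n k) (x : Fin n → X) (m : Fin n → Fin (2 ^ k)) : ℝ :=
  ∏ i, (P.q i (history m i)).prob (x i) (m i)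

/-- Blackboard protocols, as complete binary trees of depth `n * k`. An internal tree node is the
sequence `v` of the `j < n * k` bits already written on the blackboard. The next bit is written by
node `label j v`, and equals `1` with probability `bit j v x` when that node holds the sample `x`.
Along every path from the root to a leaf, each node writes exactly `k` bits. -/
structure BlackboardProtocol (X : Type*) [MeasurableSpace X] (n k : ℕ) where
  label : (j : Fin (n * k)) → (Fin (j : ℕ) → Bool) → Fin n
  bit : (j : Fin (n * k)) → (Fin (j : ℕ) → Bool) → X → ℝ
  measurable_bit : ∀ j v, Measurable (bit j v)
  bit_mem : ∀ j v x, bit j v x ∈ Set.Icc (0 : ℝ) 1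
  card_label : ∀ (y : Fin (n * k) → Bool) (i : Fin n),
    (Finset.univ.filter fun j => label j (history y j) = i).card = k

/-- Conditional probability of the transcript `y ∈ {0,1}^{nk}` given the samples `x`. -/
def BlackboardProtocol.transcriptProb {X : Type*} [MeasurableSpace X] {n k : ℕ}
    (P : BlackboardProtocol X n k) (x : Fin n → X) (y : Fin (n * k) → Bool) : ℝ :=
  ∏ j, if y j = true
    then P.bit j (history y j) (x (P.label j (history y j)))
    else 1 - P.bit j (history y j) (x (P.label j (history y j)))

/-- The likelihood of the transcript `y` when the samples `X₁, …, Xₙ` are i.i.d. with law `μ` and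
`p x y` is the conditional probability of the transcript `y` given the samples `x`. -/
def likelihood {X Y : Type*} [MeasurableSpace X] {n : ℕ} (μ : Measure X)
    (p : (Fin n → X) → Y → ℝ) (y : Y) : ℝ :=
  ∫ x, p x y ∂(Measure.pi fun _ : Fin n => μ)

/-- The centered Gaussian law `N(0, diag(θ₁, …, θ_d))` on `ℝ^d`. -/
def gaussianDiag {d : ℕ} (θ : EuclideanSpace ℝ (Fin d)) : Measure (EuclideanSpace ℝ (Fin d)) :=
  multivariateGaussian 0 (Matrix.diagonal fun i => θ i)

/-- The squared `ℓ²` risk `E_θ ‖θhat(Y) - θ‖²` of the estimator `θhat`, where `Y` is the transcript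
produced from `n` i.i.d. samples of `N(0, diag θ)`. -/
def risk {d n : ℕ} {Y : Type*} [Fintype Y]
    (p : (Fin n → EuclideanSpace ℝ (Fin d)) → Y → ℝ)
    (θhat : Y → EuclideanSpace ℝ (Fin d)) (θ : EuclideanSpace ℝ (Fin d)) : ℝ :=
  ∑ y, likelihood (gaussianDiag θ) p y * ‖θhat y - θ‖ ^ 2

/-- The worst-case risk over `Θ`, possibly infinite. -/
def worstCaseRisk {d n : ℕ} {Y : Type*} [Fintype Y] (Θ : Set (EuclideanSpace ℝ (Fin d)))
    (p : (Fin n → EuclideanSpace ℝ (Fin d)) → Y → ℝ)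
    (θhat : Y → EuclideanSpace ℝ (Fin d)) : ℝ≥0∞ :=
  ⨆ θ ∈ Θ, ENNReal.ofReal (risk p θhat θ)

/-- The rate `σ_min⁴ max {d² / (n k²), d / n}`. -/
def covarianceRate (n k d : ℕ) (σmin : ℝ) : ℝ :=
  σmin ^ 4 * max ((d : ℝ) ^ 2 / ((n : ℝ) * (k : ℝ) ^ 2)) ((d : ℝ) / (n : ℝ))

end DistributedEstimation

end

noncomputable section

namespace DistributedEstimation

/-! The bound is a van Trees inequality on the cube of variances, combined with a bound on the trace
of the Fisher information carried by a transcript.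

All three protocol types give transcript probabilities `∏ i, f i y (x i)`. Hence the samples stay
independent given the transcript, and the conditional means of a centered score at different nodes
are orthogonal. The information is therefore a sum over nodes (`sum_score_sq_div_lik`). The
contribution of one node is bounded in two ways. Conditioning cannot increase second moments, which
gives order `d`. Also, conditioning on an event of probability `p` moves the mean of a
subexponential vector by at most order `1 + log (1/p)` in norm; since the mean of `1/p` over
transcripts is at most `2 ^ k` (`sum_lik_div_mass_le`), this gives order `k ^ 2`. The second bound
holds for the whole vector at once because the Gaussian variance score is subexponential in every
direction (`isSubexpScore_gaussianVec`). The outcome is `fisher_trace_le`, with trace of order `n *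
min (k ^ 2) d / σmin ^ 4`.

For the Bayesian step, the error times the likelihood times a weight vanishing at the endpoints is
integrated by parts over a uniform prior (`card_mul_le_of_risk_le`). The mean of the weight is then
controlled by the correlations of the error with the score and with the derivative of the weight,
and Cauchy–Schwarz bounds both through the risk. The assumed inequality between `n`, `d`, `k` and
the variances makes the prior term no larger than the information term. -/

/-- A family of conditional transcript probabilities `p(y | x) = ∏ i, f i y (x i)` which factorizes
over the nodes, and whose total mass after removing one node is at most `K`. -/
structure ProductTranscript (ι Y X : Type*) [Fintype ι] [DecidableEq ι] [Fintype Y]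
    [MeasurableSpace X] (K : ℝ) where
  f : ι → Y → X → ℝ
  measurable_f : ∀ i y, Measurable (f i y)
  nonneg_f : ∀ i y x, 0 ≤ f i y x
  le_one_f : ∀ i y x, f i y x ≤ 1
  sum_prod : ∀ x : ι → X, ∑ y, ∏ i, f i y (x i) = 1
  sum_prod_drop : ∀ (i : ι) (x : ι → X), ∑ y, ∏ l, (if l = i then 1 else f l y (x l)) ≤ K

/-! ### Likelihood, conditional means and score of a factorized transcript -/

namespace ProductTranscript

variable {ι Y X : Type*} [Fintype ι] [DecidableEq ι] [Fintype Y] [MeasurableSpace X] {K : ℝ}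

/-- Precomposition of all node strategies with a measurable map. -/
def comap {X' : Type*} [MeasurableSpace X'] (T : ProductTranscript ι Y X K) (e : X' → X)
    (he : Measurable e) : ProductTranscript ι Y X' K where
  f i y x := T.f i y (e x)
  measurable_f i y := (T.measurable_f i y).comp he
  nonneg_f i y x := T.nonneg_f i y (e x)
  le_one_f i y x := T.le_one_f i y (e x)
  sum_prod x := T.sum_prod fun i => e (x i)
  sum_prod_drop i x := T.sum_prod_drop i fun l => e (x l)

/-- The factor of node `i` in the likelihood of the transcript `y`. -/
def mass (T : ProductTranscript ι Y X K) (μ : Measure X) (i : ι) (y : Y) : ℝ :=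
  ∫ x, T.f i y x ∂μ

/-- The likelihood of the transcript `y`. -/
def lik (T : ProductTranscript ι Y X K) (μ : Measure X) (y : Y) : ℝ := ∏ i, T.mass μ i y

/-- The conditional expectation of the statistic `s` of sample `i` given the transcript `y`. -/
def condMean (T : ProductTranscript ι Y X K) (μ : Measure X) (s : X → ℝ) (i : ι) (y : Y) : ℝ :=
  (∫ x, T.f i y x * s x ∂μ) / T.mass μ i y

/-- The unnormalized conditional expectation of `∑ i, s (X i)` given the transcript `y`. -/
def score (T : ProductTranscript ι Y X K) (μ : Measure X) (s : X → ℝ) (y : Y) : ℝ :=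
  ∫ x, (∏ i, T.f i y (x i)) * ∑ i, s (x i) ∂Measure.pi fun _ : ι => μ

variable (T : ProductTranscript ι Y X K) (μ : Measure X)

lemma integrable_f_mul {s : X → ℝ} (hs : Integrable s μ) (i : ι) (y : Y) :
    Integrable (fun x => T.f i y x * s x) μ :=
  hs.bdd_mul (T.measurable_f i y).aestronglyMeasurable (c := 1) (ae_of_all _ fun x => by
    rw [Real.norm_of_nonneg (T.nonneg_f i y x)]; exact T.le_one_f i y x)

lemma mass_nonneg (i : ι) (y : Y) : 0 ≤ T.mass μ i y := integral_nonneg (T.nonneg_f i y)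

lemma lik_nonneg (y : Y) : 0 ≤ T.lik μ y := Finset.prod_nonneg fun i _ => T.mass_nonneg μ i y

variable [IsProbabilityMeasure μ]

lemma integrable_f (i : ι) (y : Y) : Integrable (T.f i y) μ := by
  simpa using T.integrable_f_mul μ (integrable_const (1 : ℝ)) i y

lemma mass_le_one (i : ι) (y : Y) : T.mass μ i y ≤ 1 := by
  have := integral_mono (T.integrable_f μ i y) (integrable_const (1 : ℝ)) (T.le_one_f i y)
  simpa [mass] using this

lemma integral_prod_f (y : Y) :
    ∫ x, ∏ i, T.f i y (x i) ∂(Measure.pi fun _ : ι => μ) = T.lik μ y :=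
  integral_fintype_prod_eq_prod (fun i => T.f i y)

lemma moment_eq_zero_of_mass_eq_zero {i : ι} {y : Y} (h : T.mass μ i y = 0) (s : X → ℝ) :
    ∫ x, T.f i y x * s x ∂μ = 0 := by
  have h0 := (integral_eq_zero_iff_of_nonneg (T.nonneg_f i y) (T.integrable_f μ i y)).1 h
  refine integral_eq_zero_of_ae ?_
  filter_upwards [h0] with x hx
  simp only [Pi.zero_apply] at hx ⊢
  rw [hx, zero_mul]

lemma mass_mul_condMean (s : X → ℝ) (i : ι) (y : Y) :
    T.mass μ i y * T.condMean μ s i y = ∫ x, T.f i y x * s x ∂μ := by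
  by_cases h : T.mass μ i y = 0
  · rw [h, zero_mul, T.moment_eq_zero_of_mass_eq_zero μ h]
  · rw [condMean, mul_div_cancel₀ _ h]

/-- Under the integral the transcript probabilities add up to one, so a weight that factorizes over
the nodes keeps its full integral. The moment identities below are instances with weights `1`, `s`
or `s ^ 2` at chosen nodes. -/
lemma sum_prod_weighted (g : ι → X → ℝ) (hg : ∀ i, Integrable (g i) μ) :
    ∑ y, ∏ i, ∫ x, T.f i y x * g i x ∂μ = ∏ i, ∫ x, g i x ∂μ := by
  have h (y : Y) : Integrable (fun x : ι → X => ∏ i, (T.f i y (x i) * g i (x i)))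
      (Measure.pi fun _ : ι => μ) :=
    Integrable.fintype_prod (fun i => T.integrable_f_mul μ (hg i) i y)
  simp_rw [← integral_fintype_prod_eq_prod (μ := fun _ : ι => μ)]
  rw [← integral_finsetSum _ fun y _ => h y]
  congr 1
  ext x
  simp_rw [Finset.prod_mul_distrib]
  rw [← Finset.sum_mul, T.sum_prod, one_mul]

lemma sum_lik : ∑ y, T.lik μ y = 1 := by
  have := T.sum_prod_weighted μ (fun _ _ => 1) (fun _ => integrable_const _)
  simpa [lik, mass] using this

/-- The samples are conditionally independent given `y`, so each summand only changes the factor of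
its own node. -/
lemma score_eq {s : X → ℝ} (hs : Integrable s μ) (y : Y) :
    T.score μ s y = T.lik μ y * ∑ i, T.condMean μ s i y := by
  have hprod (x : ι → X) (i : ι) : (∏ l, T.f l y (x l)) * s (x i) =
      ∏ l, (T.f l y (x l) * (if l = i then s (x l) else 1)) := by
    rw [Finset.prod_mul_distrib]; simp
  have hint (i l : ι) : Integrable (fun x => T.f l y x * (if l = i then s x else 1)) μ := by
    split_ifs
    · exact T.integrable_f_mul μ hs l y
    · simpa using T.integrable_f μ l y
  unfold score
  simp_rw [Finset.mul_sum, hprod]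
  rw [integral_finsetSum]
  · refine Finset.sum_congr rfl fun i _ => ?_
    rw [integral_fintype_prod_eq_prod (μ := fun _ : ι => μ)
      (fun l x => T.f l y x * (if l = i then s x else 1))]
    have : T.lik μ y * T.condMean μ s i y =
        ∏ l, (T.mass μ l y * (if l = i then T.condMean μ s l y else 1)) := by
      rw [Finset.prod_mul_distrib, lik]; simp
    rw [this]
    refine Finset.prod_congr rfl fun l _ => ?_
    split_ifs
    · rw [mass_mul_condMean]
    · simp [mass]
  · exact fun i _ => Integrable.fintype_prod (f := fun l x => T.f l y x * (if l = i then s x else 1))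
      (hint i)

/-- By conditional independence the product of conditional means is the conditional mean of `s (x i)
* s (x i')`. Its average over transcripts is the square of the mean of `s`. -/
lemma sum_lik_mul_condMean_mul_condMean {s : X → ℝ} (hs : Integrable s μ) (h0 : ∫ x, s x ∂μ = 0)
    {i i' : ι} (hii : i ≠ i') :
    ∑ y, T.lik μ y * (T.condMean μ s i y * T.condMean μ s i' y) = 0 := by
  have key (y : Y) : T.lik μ y * (T.condMean μ s i y * T.condMean μ s i' y) =
      ∏ l, ∫ x, T.f l y x * (if l = i ∨ l = i' then s x else 1) ∂μ := by
    have : T.lik μ y * (T.condMean μ s i y * T.condMean μ s i' y) =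
        ∏ l, (T.mass μ l y * ((if l = i then T.condMean μ s l y else 1) *
          (if l = i' then T.condMean μ s l y else 1))) := by
      rw [Finset.prod_mul_distrib, Finset.prod_mul_distrib, lik]; simp
    rw [this]
    refine Finset.prod_congr rfl fun l _ => ?_
    by_cases h1 : l = i
    · have h2 : l ≠ i' := h1 ▸ hii
      simp [h1, hii, mass_mul_condMean]
    · by_cases h2 : l = i'
      · simp [h2, hii.symm, mass_mul_condMean]
      · simp [h1, h2, mass]
  simp_rw [key]
  rw [T.sum_prod_weighted μ (fun l x => if l = i ∨ l = i' then s x else 1)]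
  · exact Finset.prod_eq_zero (Finset.mem_univ i) (by simpa using h0)
  · intro l
    split_ifs
    · exact hs
    · exact integrable_const _

/-- Additivity of information: expanding the square, the cross terms vanish by orthogonality, even
for interactive protocols. -/
lemma sum_score_sq_div_lik {s : X → ℝ} (hs : Integrable s μ) (h0 : ∫ x, s x ∂μ = 0) :
    ∑ y, T.score μ s y ^ 2 / T.lik μ y = ∑ i, ∑ y, T.lik μ y * T.condMean μ s i y ^ 2 := by
  have h1 (y : Y) : T.score μ s y ^ 2 / T.lik μ y =
      ∑ i, ∑ i', T.lik μ y * (T.condMean μ s i y * T.condMean μ s i' y) := by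
    rw [T.score_eq μ hs]
    simp_rw [← Finset.mul_sum]
    simp_rw [← Finset.sum_mul]
    by_cases h : T.lik μ y = 0
    · simp [h]
    · field_simp
  simp_rw [h1]
  rw [Finset.sum_comm]
  refine Finset.sum_congr rfl fun i _ => ?_
  rw [Finset.sum_comm, Finset.sum_eq_single i]
  · simp_rw [sq]
  · exact fun i' _ hi' => T.sum_lik_mul_condMean_mul_condMean μ hs h0 hi'.symm
  · simp

/-- Nonnegativity of the conditional variance, multiplied by the mass to avoid division. -/
lemma mass_mul_condMean_sq_le {s : X → ℝ} (hs : MemLp s 2 μ) (i : ι) (y : Y) :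
    T.mass μ i y * T.condMean μ s i y ^ 2 ≤ ∫ x, T.f i y x * s x ^ 2 ∂μ := by
  have hs1 := hs.integrable one_le_two
  have hs2 := hs.integrable_sq
  set c := T.condMean μ s i y
  have h : 0 ≤ ∫ x, T.f i y x * (s x - c) ^ 2 ∂μ :=
    integral_nonneg fun x => mul_nonneg (T.nonneg_f i y x) (sq_nonneg _)
  have h2 : ∫ x, T.f i y x * (s x - c) ^ 2 ∂μ = (∫ x, T.f i y x * s x ^ 2 ∂μ)
      - 2 * c * (∫ x, T.f i y x * s x ∂μ) + c ^ 2 * T.mass μ i y := by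
    have e : (fun x => T.f i y x * (s x - c) ^ 2) = fun x => T.f i y x * s x ^ 2
      - 2 * c * (T.f i y x * s x) + c ^ 2 * T.f i y x := by ext x; ring
    rw [e, integral_add, integral_sub, integral_const_mul, integral_const_mul, mass]
    · exact T.integrable_f_mul μ hs2 i y
    · exact (T.integrable_f_mul μ hs1 i y).const_mul _
    · exact (T.integrable_f_mul μ hs2 i y).sub ((T.integrable_f_mul μ hs1 i y).const_mul _)
    · exact (T.integrable_f μ i y).const_mul _
  rw [h2, ← T.mass_mul_condMean μ s i y] at h
  change 0 ≤ _ - 2 * c * (_ * c) + _ at h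
  nlinarith

lemma sum_lik_mul_condMean_sq_le {s : X → ℝ} (hs : MemLp s 2 μ) (i : ι) :
    ∑ y, T.lik μ y * T.condMean μ s i y ^ 2 ≤ ∫ x, s x ^ 2 ∂μ := by
  have key (y : Y) : T.lik μ y * T.condMean μ s i y ^ 2 ≤
      ∏ l, ∫ x, T.f l y x * (if l = i then s x ^ 2 else 1) ∂μ := by
    have : T.lik μ y * T.condMean μ s i y ^ 2 =
        ∏ l, (T.mass μ l y * (if l = i then T.condMean μ s l y ^ 2 else 1)) := by
      rw [Finset.prod_mul_distrib, lik]; simp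
    rw [this]
    refine Finset.prod_le_prod (fun l _ => ?_) fun l _ => ?_
    · refine mul_nonneg (T.mass_nonneg μ l y) ?_
      split_ifs <;> positivity
    · split_ifs
      · exact T.mass_mul_condMean_sq_le μ hs l y
      · simp [mass]
  refine (Finset.sum_le_sum fun y _ => key y).trans ?_
  rw [T.sum_prod_weighted μ (fun l x => if l = i then s x ^ 2 else 1)]
  · rw [Finset.prod_eq_single i]
    · simp
    · intro l _ hl; simp [hl]
    · simp
  · intro l
    split_ifs
    · exact hs.integrable_sq
    · exact integrable_const _

/-- Dividing by the mass deletes the factor of node `i`, so `sum_prod_drop` applies. The sum acts as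
an effective number of messages of node `i`: with interaction there are far more transcripts than `2
^ k`, and plain counting would fail. -/
lemma sum_lik_div_mass_le (i : ι) : ∑ y, T.lik μ y / T.mass μ i y ≤ K := by
  have key (y : Y) : T.lik μ y / T.mass μ i y ≤
      ∫ x, ∏ l, (if l = i then 1 else T.f l y (x l)) ∂(Measure.pi fun _ : ι => μ) := by
    rw [integral_fintype_prod_eq_prod (μ := fun _ : ι => μ)
      (fun l x => if l = i then 1 else T.f l y x)]
    have h : ∀ l, ∫ x, (if l = i then 1 else T.f l y x) ∂μ =
        if l = i then 1 else T.mass μ l y := by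
      intro l; split_ifs <;> simp [mass]
    simp_rw [h]
    have hnn : 0 ≤ ∏ l, (if l = i then 1 else T.mass μ l y) :=
      Finset.prod_nonneg fun l _ => by
        split_ifs
        · exact zero_le_one
        · exact T.mass_nonneg μ l y
    by_cases hz : T.mass μ i y = 0
    · simpa [hz] using hnn
    · rw [div_le_iff₀ (lt_of_le_of_ne (T.mass_nonneg μ i y) (Ne.symm hz))]
      apply le_of_eq
      have : T.mass μ i y = ∏ l, (if l = i then T.mass μ l y else 1) := by simp
      rw [this, ← Finset.prod_mul_distrib, lik]
      refine Finset.prod_congr rfl fun l _ => ?_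
      split_ifs <;> simp
  have hint (y : Y) : Integrable (fun x : ι → X => ∏ l, (if l = i then 1 else T.f l y (x l)))
      (Measure.pi fun _ : ι => μ) := by
    refine Integrable.fintype_prod (f := fun l x => if l = i then 1 else T.f l y x) fun l => ?_
    split_ifs
    · exact integrable_const _
    · exact T.integrable_f μ l y
  refine (Finset.sum_le_sum fun y _ => key y).trans ?_
  rw [← integral_finsetSum _ fun y _ => hint y]
  refine (integral_mono (integrable_finsetSum _ fun y _ => hint y) (integrable_const K)
    (T.sum_prod_drop i)).trans ?_
  simp

end ProductTranscript

/-! ### Subexponential vectors -/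

/-- Gibbs' variational bound for the truncated first moment of a variable with an exponential
moment. -/
lemma integral_mul_le_of_exp_moment {X : Type*} [MeasurableSpace X] {μ : Measure X}
    {f s : X → ℝ} {M : ℝ} (hf0 : ∀ x, 0 ≤ f x) (hf1 : ∀ x, f x ≤ 1)
    (hf : Integrable f μ) (hfs : Integrable (fun x => f x * s x) μ)
    (hexp : Integrable (fun x => Real.exp (s x)) μ)
    (hM : ∫ x, Real.exp (s x) ∂μ ≤ M) (hpos : 0 < ∫ x, f x ∂μ) :
    ∫ x, f x * s x ∂μ ≤ (∫ x, f x ∂μ) * (M - 1 + Real.log (∫ x, f x ∂μ)⁻¹) := by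
  set p := ∫ x, f x ∂μ
  have key (x : X) : f x * s x ≤ p * Real.exp (s x) + (Real.log p⁻¹ - 1) * f x := by
    -- This is `1 + v ≤ exp v` at `v = s x + log p`; the shift is what produces `log p⁻¹`.
    have h1 : s x ≤ p * Real.exp (s x) + (Real.log p⁻¹ - 1) := by
      have := Real.add_one_le_exp (s x + Real.log p)
      rw [Real.exp_add, Real.exp_log hpos] at this
      rw [Real.log_inv]
      linarith
    have h2 : f x * (p * Real.exp (s x)) ≤ p * Real.exp (s x) :=
      mul_le_of_le_one_left (by positivity) (hf1 x)
    have := mul_le_mul_of_nonneg_left h1 (hf0 x)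
    linarith
  have h := integral_mono hfs ((hexp.const_mul p).add (hf.const_mul (Real.log p⁻¹ - 1))) key
  rw [integral_add' (hexp.const_mul p) (hf.const_mul (Real.log p⁻¹ - 1)), integral_const_mul,
    integral_const_mul] at h
  change _ ≤ p * _ + _ * p at h
  nlinarith [mul_le_mul_of_nonneg_left hM hpos.le]

/-- A centered random vector `S` all of whose unit projections, scaled by `r`, have exponential
moment at most `2`. -/
structure IsSubexpScore {κ X : Type*} [Fintype κ] [MeasurableSpace X] (μ : Measure X)
    (S : κ → X → ℝ) (r : ℝ) : Prop where
  measurable : ∀ j, Measurable (S j)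
  mean_zero : ∀ j, ∫ x, S j x ∂μ = 0
  integrable_exp : ∀ u : κ → ℝ, ∑ j, u j ^ 2 ≤ 1 →
    Integrable (fun x => Real.exp (r * ∑ j, u j * S j x)) μ
  exp_le : ∀ u : κ → ℝ, ∑ j, u j ^ 2 ≤ 1 → ∫ x, Real.exp (r * ∑ j, u j * S j x) ∂μ ≤ 2

namespace IsSubexpScore

variable {κ X : Type*} [Fintype κ] [MeasurableSpace X] {μ : Measure X}
  {S : κ → X → ℝ} {r : ℝ}

lemma sq_le_exp_add_exp (x : ℝ) : x ^ 2 ≤ 2 * (Real.exp x + Real.exp (-x) - 2) := by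
  rcases le_total 0 x with h | h
  · nlinarith [Real.quadratic_le_exp_of_nonneg h, Real.add_one_le_exp (-x)]
  · nlinarith [Real.quadratic_le_exp_of_nonneg (neg_nonneg.2 h), Real.add_one_le_exp x]

/-- Specialization to the directions `± e_j`; two-sided exponential moments control the coordinate
moments. -/
lemma exp_single (hS : IsSubexpScore μ S r) (j : κ) :
    Integrable (fun x => Real.exp (r * S j x)) μ ∧ Integrable (fun x => Real.exp (-(r * S j x))) μ ∧
      ∫ x, Real.exp (r * S j x) ∂μ ≤ 2 ∧ ∫ x, Real.exp (-(r * S j x)) ∂μ ≤ 2 := by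
  classical
  have h1 : ∑ i, (Pi.single j (1 : ℝ) : κ → ℝ) i ^ 2 ≤ 1 := by
    simp [Pi.single_apply, ite_pow]
  have h2 : ∑ i, (Pi.single j (-1 : ℝ) : κ → ℝ) i ^ 2 ≤ 1 := by
    simp [Pi.single_apply, ite_pow]
  have e1 := hS.integrable_exp _ h1
  have e2 := hS.integrable_exp _ h2
  have e3 := hS.exp_le _ h1
  have e4 := hS.exp_le _ h2
  simp [Pi.single_apply] at e1 e2 e3 e4
  exact ⟨e1, e2, e3, e4⟩

variable [IsProbabilityMeasure μ]

lemma memLp_two (hS : IsSubexpScore μ S r) (hr : 0 < r) (j : κ) : MemLp (S j) 2 μ := by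
  obtain ⟨h1, h2, -, -⟩ := hS.exp_single j
  rw [memLp_two_iff_integrable_sq (hS.measurable j).aestronglyMeasurable]
  refine (((h1.add h2).sub (integrable_const 2)).const_mul (2 / r ^ 2)).mono'
    ((hS.measurable j).pow_const 2).aestronglyMeasurable (ae_of_all _ fun x => ?_)
  rw [Real.norm_of_nonneg (sq_nonneg _)]
  have := sq_le_exp_add_exp (r * S j x)
  simp only [Pi.add_apply, Pi.sub_apply]
  rw [div_mul_eq_mul_div, le_div_iff₀ (by positivity)]
  linarith

lemma integrable (hS : IsSubexpScore μ S r) (hr : 0 < r) (j : κ) : Integrable (S j) μ :=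
  (hS.memLp_two hr j).integrable one_le_two

lemma integral_sq_le (hS : IsSubexpScore μ S r) (hr : 0 < r) (j : κ) :
    ∫ x, S j x ^ 2 ∂μ ≤ 4 / r ^ 2 := by
  obtain ⟨h1, h2, h3, h4⟩ := hS.exp_single j
  have h := integral_mono ((hS.memLp_two hr j).integrable_sq.const_mul (r ^ 2))
    (((h1.add h2).sub (integrable_const 2)).const_mul 2) (fun x => by
      have := sq_le_exp_add_exp (r * S j x)
      simp only [Pi.add_apply, Pi.sub_apply]
      linarith)
  rw [integral_const_mul, integral_const_mul, integral_sub' (h1.add h2) (integrable_const 2),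
    integral_add' h1 h2] at h
  simp at h
  rw [le_div_iff₀ (by positivity)]
  linarith

lemma integral_abs_le (hS : IsSubexpScore μ S r) (hr : 0 < r) (j : κ) :
    ∫ x, |S j x| ∂μ ≤ 1 + 4 / r ^ 2 := by
  have h := integral_mono (hS.integrable hr j).abs
    ((integrable_const 1).add (hS.memLp_two hr j).integrable_sq) (fun x => by
      simp only [Pi.add_apply]
      nlinarith [sq_nonneg (|S j x| - 1), sq_abs (S j x), sq_nonneg (S j x)])
  rw [integral_add' (integrable_const 1) (hS.memLp_two hr j).integrable_sq] at h
  simp at h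
  linarith [hS.integral_sq_le hr j]

end IsSubexpScore

/-! ### Trace of the Fisher information -/

namespace ProductTranscript

variable {ι κ Y X : Type*} [Fintype ι] [DecidableEq ι] [Fintype κ] [Fintype Y] [MeasurableSpace X]
  {K : ℝ} (T : ProductTranscript ι Y X K) {μ : Measure X} [IsProbabilityMeasure μ]
  {S : κ → X → ℝ} {r : ℝ}

/-- The Gibbs bound is applied in the direction `c / N` of the conditional mean itself, where the
projection equals the norm `N`. One scalar inequality thus bounds the whole vector, without a factor
of the dimension. -/
lemma sum_condMean_sq_le (hS : IsSubexpScore μ S r) (hr : 0 < r) {i : ι} {y : Y}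
    (hpos : 0 < T.mass μ i y) :
    ∑ j, T.condMean μ (S j) i y ^ 2 ≤ ((1 + Real.log (T.mass μ i y)⁻¹) / r) ^ 2 := by
  set c : κ → ℝ := fun j => T.condMean μ (S j) i y with hc
  set N := √(∑ j, c j ^ 2) with hN
  have hNsq : N ^ 2 = ∑ j, c j ^ 2 := Real.sq_sqrt (Finset.sum_nonneg fun j _ => sq_nonneg _)
  change ∑ j, c j ^ 2 ≤ _
  have hlog : 0 ≤ Real.log (T.mass μ i y)⁻¹ :=
    Real.log_nonneg ((one_le_inv₀ hpos).2 (T.mass_le_one μ i y))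
  rw [← hNsq]
  have hN0 : 0 ≤ N := Real.sqrt_nonneg _
  refine pow_le_pow_left₀ hN0 ?_ 2
  rcases hN0.eq_or_lt with h0 | hNpos
  · rw [← h0]; positivity
  have hu : ∑ j, (c j / N) ^ 2 ≤ 1 := by
    simp_rw [div_pow]
    rw [← Finset.sum_div, ← hNsq, div_self (by positivity)]
  have hint (j : κ) := T.integrable_f_mul μ (hS.integrable hr j) i y
  have hfe : (fun x => T.f i y x * (r * ∑ j, c j / N * S j x)) =
      fun x => r * ∑ j, c j / N * (T.f i y x * S j x) := by
    ext x
    simp_rw [Finset.mul_sum]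
    exact Finset.sum_congr rfl fun j _ => by ring
  have hfs : Integrable (fun x => T.f i y x * (r * ∑ j, c j / N * S j x)) μ := by
    rw [hfe]
    exact (integrable_finsetSum _ fun j _ => (hint j).const_mul _).const_mul r
  have h := integral_mul_le_of_exp_moment (T.nonneg_f i y) (T.le_one_f i y) (T.integrable_f μ i y)
    hfs (hS.integrable_exp _ hu) (hS.exp_le _ hu) hpos
  rw [hfe, integral_const_mul, integral_finsetSum _ fun j _ => (hint j).const_mul _] at h
  simp_rw [integral_const_mul, ← T.mass_mul_condMean μ] at h
  have e : ∑ j, c j / N * (T.mass μ i y * T.condMean μ (S j) i y) = T.mass μ i y * N := by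
    calc _ = T.mass μ i y / N * ∑ j, c j ^ 2 := by
          rw [Finset.mul_sum]
          refine Finset.sum_congr rfl fun j _ => ?_
          rw [hc]; ring
      _ = _ := by rw [← hNsq]; field_simp
  rw [e] at h
  change r * (T.mass μ i y * N) ≤ T.mass μ i y * (2 - 1 + Real.log (T.mass μ i y)⁻¹) at h
  rw [le_div_iff₀ hr]
  have : T.mass μ i y * (N * r) ≤ T.mass μ i y * (1 + Real.log (T.mass μ i y)⁻¹) := by linarith
  exact le_of_mul_le_mul_left this hpos

/-- Split `log p⁻¹` as `k * log 2 + log u` and use `log u ≤ 2 * √u`. The square root is chosen so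
that squaring leaves a term linear in `p⁻¹`, whose average `sum_lik_div_mass_le` controls. -/
lemma one_add_log_inv_le {k : ℕ} (hk : 1 ≤ k) {p : ℝ} (hp : 0 < p) :
    1 + Real.log p⁻¹ ≤ 2 * k + 2 * √(p⁻¹ / 2 ^ k) := by
  have hk' : (1 : ℝ) ≤ k := by exact_mod_cast hk
  set u := p⁻¹ / 2 ^ k with hu
  have hup : 0 < u := by positivity
  have h1 : p⁻¹ = 2 ^ k * u := by rw [hu]; field_simp
  rw [h1, Real.log_mul (by positivity) hup.ne', Real.log_pow]
  have h2 : Real.log u ≤ 2 * √u := by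
    have h := Real.log_le_sub_one_of_pos (Real.sqrt_pos.2 hup)
    rw [Real.log_sqrt hup.le] at h
    linarith
  have h3 : (k : ℝ) * Real.log 2 ≤ k :=
    mul_le_of_le_one_right (by positivity) (by linarith [Real.log_two_lt_d9])
  linarith

lemma sum_sum_lik_mul_condMean_sq_le_bits {k : ℕ} (hk : 1 ≤ k) (hK : K = 2 ^ k)
    (hS : IsSubexpScore μ S r) (hr : 0 < r) (i : ι) :
    ∑ j, ∑ y, T.lik μ y * T.condMean μ (S j) i y ^ 2 ≤ 16 * k ^ 2 / r ^ 2 := by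
  have hk' : (1 : ℝ) ≤ k := by exact_mod_cast hk
  rw [Finset.sum_comm]
  simp_rw [← Finset.mul_sum]
  have key (y : Y) : T.lik μ y * ∑ j, T.condMean μ (S j) i y ^ 2 ≤
      8 * k ^ 2 / r ^ 2 * T.lik μ y + 8 / r ^ 2 / 2 ^ k * (T.lik μ y / T.mass μ i y) := by
    rcases (T.mass_nonneg μ i y).eq_or_lt with h | h
    · have : T.lik μ y = 0 := Finset.prod_eq_zero (Finset.mem_univ i) h.symm
      simp [this]
    · have h1 := T.sum_condMean_sq_le hS hr h
      have h2 := one_add_log_inv_le hk h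
      have hlog : 0 ≤ Real.log (T.mass μ i y)⁻¹ :=
        Real.log_nonneg ((one_le_inv₀ h).2 (T.mass_le_one μ i y))
      set u := (T.mass μ i y)⁻¹ / 2 ^ k with hu
      have hu0 : 0 ≤ u := by positivity
      have h3 : (1 + Real.log (T.mass μ i y)⁻¹) ^ 2 ≤ 8 * k ^ 2 + 8 * u := by
        refine (pow_le_pow_left₀ (by linarith) h2 2).trans ?_
        nlinarith [sq_nonneg (2 * (k : ℝ) - 2 * √u), Real.sq_sqrt hu0]
      have h4 : ∑ j, T.condMean μ (S j) i y ^ 2 ≤ (8 * k ^ 2 + 8 * u) / r ^ 2 := by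
        refine h1.trans ?_
        rw [div_pow]
        gcongr
      calc _ ≤ T.lik μ y * ((8 * k ^ 2 + 8 * u) / r ^ 2) :=
            mul_le_mul_of_nonneg_left h4 (T.lik_nonneg μ y)
        _ = _ := by rw [hu]; ring
  refine (Finset.sum_le_sum fun y _ => key y).trans ?_
  rw [Finset.sum_add_distrib, ← Finset.mul_sum, ← Finset.mul_sum, T.sum_lik]
  have h5 := (T.sum_lik_div_mass_le μ i).trans_eq hK
  -- The effective message count cancels the `2 ^ k`, leaving a remainder absorbed into the `k ^ 2`
  -- term because `1 ≤ k`.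
  have h6 : 8 / r ^ 2 / 2 ^ k * ∑ y, T.lik μ y / T.mass μ i y ≤ 8 / r ^ 2 := by
    calc _ ≤ 8 / r ^ 2 / 2 ^ k * 2 ^ k := by gcongr
      _ = _ := by field_simp
  have h7 : 8 / r ^ 2 ≤ 8 * (k : ℝ) ^ 2 / r ^ 2 := by
    gcongr
    nlinarith
  calc _ ≤ 8 * (k : ℝ) ^ 2 / r ^ 2 * 1 + 8 * (k : ℝ) ^ 2 / r ^ 2 := by linarith
    _ = _ := by ring

lemma sum_sum_lik_mul_condMean_sq_le_dim (hS : IsSubexpScore μ S r) (hr : 0 < r) (i : ι) :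
    ∑ j, ∑ y, T.lik μ y * T.condMean μ (S j) i y ^ 2 ≤ 16 * Fintype.card κ / r ^ 2 := by
  calc _ ≤ ∑ _j : κ, 4 / r ^ 2 := Finset.sum_le_sum fun j _ =>
        (T.sum_lik_mul_condMean_sq_le μ (hS.memLp_two hr j) i).trans (hS.integral_sq_le hr j)
    _ = 4 * Fintype.card κ / r ^ 2 := by simp; ring
    _ ≤ _ := by gcongr; norm_num

/-- The trace of the Fisher information of a transcript. -/
theorem fisher_trace_le {k : ℕ} (hk : 1 ≤ k) (hK : K = 2 ^ k)
    (hS : IsSubexpScore μ S r) (hr : 0 < r) :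
    ∑ j, ∑ y, T.score μ (S j) y ^ 2 / T.lik μ y ≤
      16 / r ^ 2 * (Fintype.card ι * min ((k : ℝ) ^ 2) (Fintype.card κ)) := by
  have h1 (j : κ) := T.sum_score_sq_div_lik μ (hS.integrable hr j) (hS.mean_zero j)
  simp_rw [h1]
  rw [Finset.sum_comm]
  calc _ ≤ ∑ _i : ι, 16 / r ^ 2 * min ((k : ℝ) ^ 2) (Fintype.card κ) := by
        refine Finset.sum_le_sum fun i _ => ?_
        rw [mul_min_of_nonneg _ _ (by positivity)]
        refine le_min ?_ ?_
        · rw [div_mul_eq_mul_div]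
          exact T.sum_sum_lik_mul_condMean_sq_le_bits hk hK hS hr i
        · rw [div_mul_eq_mul_div]
          exact T.sum_sum_lik_mul_condMean_sq_le_dim hS hr i
    _ = _ := by simp; ring

/-- Makes the convention `x / 0 = 0` harmless in the information: impossible transcripts carry no
score. -/
lemma score_eq_zero_of_lik_eq_zero (hS : IsSubexpScore μ S r) (hr : 0 < r) {y : Y}
    (h : T.lik μ y = 0) (j : κ) : T.score μ (S j) y = 0 := by
  rw [T.score_eq μ (hS.integrable hr j), h, zero_mul]

/-- Cauchy–Schwarz bound for the correlation of an error vector with the score. -/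
theorem sum_sum_abs_mul_score_le (hS : IsSubexpScore μ S r) (hr : 0 < r) (c : Y → κ → ℝ) :
    ∑ y, ∑ j, |c y j| * |T.score μ (S j) y| ≤
      √(∑ y, T.lik μ y * ∑ j, c y j ^ 2) * √(∑ j, ∑ y, T.score μ (S j) y ^ 2 / T.lik μ y) := by
  have h1 : ∑ y, ∑ j, |c y j| * |T.score μ (S j) y| = ∑ p : Y × κ,
      (√(T.lik μ p.1) * |c p.1 p.2|) * (|T.score μ (S p.2) p.1| / √(T.lik μ p.1)) := by
    rw [Fintype.sum_prod_type]
    refine Finset.sum_congr rfl fun y _ => Finset.sum_congr rfl fun j _ => ?_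
    rcases (T.lik_nonneg μ y).eq_or_lt with h | h
    · simp [T.score_eq_zero_of_lik_eq_zero hS hr h.symm]
    · have := Real.sqrt_pos.2 h
      field_simp
  have h2 : ∑ y, T.lik μ y * ∑ j, c y j ^ 2 =
      ∑ p : Y × κ, (√(T.lik μ p.1) * |c p.1 p.2|) ^ 2 := by
    rw [Fintype.sum_prod_type]
    refine Finset.sum_congr rfl fun y _ => ?_
    rw [Finset.mul_sum]
    refine Finset.sum_congr rfl fun j _ => ?_
    rw [mul_pow, Real.sq_sqrt (T.lik_nonneg μ y), sq_abs]
  have h3 : ∑ j, ∑ y, T.score μ (S j) y ^ 2 / T.lik μ y =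
      ∑ p : Y × κ, (|T.score μ (S p.2) p.1| / √(T.lik μ p.1)) ^ 2 := by
    rw [Fintype.sum_prod_type, Finset.sum_comm]
    refine Finset.sum_congr rfl fun y _ => Finset.sum_congr rfl fun j _ => ?_
    rw [div_pow, Real.sq_sqrt (T.lik_nonneg μ y), sq_abs]
  rw [h1, h2, h3]
  exact Real.sum_mul_le_sqrt_mul_sqrt _ _ _

end ProductTranscript

/-! ### Factorization of protocols over the nodes -/

lemma measurable_ite_one {X : Type*} [MeasurableSpace X] {g : X → ℝ} (c : Prop) [Decidable c]
    (hg : Measurable g) : Measurable fun x => if c then g x else 1 := by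
  split_ifs
  · exact hg
  · exact measurable_const

/-- The path probabilities of a sequentially generated finite sequence sum to one. -/
lemma sum_prod_history {A : Type*} [Fintype A] {N : ℕ}
    (g : (j : Fin N) → (Fin (j : ℕ) → A) → A → ℝ) (hg : ∀ j v, ∑ a, g j v a = 1) :
    ∑ y : Fin N → A, ∏ j, g j (history y j) (y j) = 1 := by
  induction N with
  | zero => simp
  | succ N ih =>
    rw [← (Fin.snocEquiv fun _ : Fin (N + 1) => A).sum_comp, Fintype.sum_prod_type,
      Finset.sum_comm]
    have h1 (v : Fin N → A) (j : Fin N) (a : A) :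
        history (Fin.snoc (α := fun _ => A) v a) j.castSucc = history v j := by
      ext t
      simp only [history]
      exact Fin.snoc_castSucc (α := fun _ => A) a v (Fin.castLE j.isLt.le t)
    have h2 (v : Fin N → A) (a : A) :
        history (Fin.snoc (α := fun _ => A) v a) (Fin.last N) = v := by
      ext t
      simp only [history]
      exact Fin.snoc_castSucc (α := fun _ => A) a v t
    have key (v : Fin N → A) (a : A) :
        ∏ j, g j (history (Fin.snoc (α := fun _ => A) v a) j)
            (Fin.snoc (α := fun _ => A) v a j) =
          (∏ j : Fin N, g j.castSucc (history v j) (v j)) * g (Fin.last N) v a := by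
      rw [Fin.prod_univ_castSucc, h2]
      congr 1
      · refine Finset.prod_congr rfl fun j _ => ?_
        rw [h1]
        congr 1
        exact Fin.snoc_castSucc (α := fun _ => A) a v j
      · congr 1
        exact Fin.snoc_last (α := fun _ => A) a v
    calc _ = ∑ v : Fin N → A, ∑ a,
          (∏ j : Fin N, g j.castSucc (history v j) (v j)) * g (Fin.last N) v a :=
        Finset.sum_congr rfl fun v _ => Finset.sum_congr rfl fun a _ => key v a
      _ = ∑ v : Fin N → A, ∏ j : Fin N, g j.castSucc (history v j) (v j) := by
        refine Finset.sum_congr rfl fun v _ => ?_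
        rw [← Finset.mul_sum]
        erw [hg (Fin.last N) v]
        rw [mul_one]
      _ = 1 := ih (fun j => g j.castSucc) (fun j => hg j.castSucc)

/-- The factorization over nodes of the transcript law of a tree protocol, in which position `j`
of the transcript is written by node `label j v` when the history is `v`. -/
def treeTranscript {X A : Type*} [MeasurableSpace X] [Fintype A] [Nonempty A] {n N k : ℕ}
    (label : (j : Fin N) → (Fin (j : ℕ) → A) → Fin n)
    (prob : (j : Fin N) → (Fin (j : ℕ) → A) → X → A → ℝ)
    (hmeas : ∀ j v a, Measurable fun x => prob j v x a)
    (hnonneg : ∀ j v x a, 0 ≤ prob j v x a)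
    (hsum : ∀ j v x, ∑ a, prob j v x a = 1)
    (hcard : ∀ (y : Fin N → A) (i : Fin n),
      Fintype.card A ^ (Finset.univ.filter fun j => label j (history y j) = i).card = 2 ^ k) :
    ProductTranscript (Fin n) (Fin N → A) X (2 ^ k) where
  f i y x := ∏ j, if label j (history y j) = i then prob j (history y j) x (y j) else 1
  measurable_f i y := Finset.measurable_prod _ fun j _ =>
    measurable_ite_one _ (hmeas j _ _)
  nonneg_f i y x := Finset.prod_nonneg fun j _ => by
    split_ifs
    · exact hnonneg _ _ _ _
    · exact zero_le_one
  le_one_f i y x := Finset.prod_le_one (fun j _ => by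
    split_ifs
    · exact hnonneg _ _ _ _
    · exact zero_le_one) fun j _ => by
    split_ifs
    · rw [← hsum j (history y j) x]
      exact Finset.single_le_sum (fun a _ => hnonneg _ _ _ a) (Finset.mem_univ _)
    · exact le_rfl
  sum_prod x := by
    refine Eq.trans (Finset.sum_congr rfl fun y _ => ?_)
      (sum_prod_history (fun j v a => prob j v (x (label j v)) a) fun j v => hsum j v _)
    rw [Finset.prod_comm]
    refine Finset.prod_congr rfl fun j _ => ?_
    simp
  sum_prod_drop i x := by
    have hA : (Fintype.card A : ℝ) ≠ 0 := by exact_mod_cast Fintype.card_ne_zero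
    -- Let node `i` write uniformly random letters instead. This is again a protocol, of total mass
    -- one, and along every path its letters contribute the factor `1 / 2 ^ k`. Multiplying by `2 ^
    -- k` replaces them by `1`.
    have h1 := sum_prod_history
      (fun j v a => if label j v = i then (Fintype.card A : ℝ)⁻¹ else prob j v (x (label j v)) a)
      (fun j v => by
        split_ifs
        · simp [hA]
        · exact hsum j v _)
    refine le_of_eq (Eq.trans ?_ ((congrArg (2 ^ k * ·) h1).trans (mul_one (2 ^ k : ℝ))))
    rw [Finset.mul_sum]
    refine Finset.sum_congr rfl fun y _ => ?_
    have h2 : ∏ l, (if l = i then (1 : ℝ) else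
        ∏ j, if label j (history y j) = l then prob j (history y j) (x l) (y j) else 1) =
        ∏ j, if label j (history y j) = i then 1 else
          prob j (history y j) (x (label j (history y j))) (y j) := by
      have h3 (l : Fin n) : (if l = i then (1 : ℝ) else
        ∏ j, if label j (history y j) = l then prob j (history y j) (x l) (y j) else 1) =
        ∏ j, if label j (history y j) = l then
          (if l = i then 1 else prob j (history y j) (x l) (y j)) else 1 := by
        by_cases h : l = i <;> simp [h]
      simp_rw [h3]
      rw [Finset.prod_comm]
      refine Finset.prod_congr rfl fun j _ => ?_
      simp
    have h4 : (2 ^ k : ℝ) =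
        ∏ j, if label j (history y j) = i then (Fintype.card A : ℝ) else 1 := by
      rw [Finset.prod_ite, Finset.prod_const_one, mul_one, Finset.prod_const]
      exact_mod_cast (hcard y i).symm
    rw [h2, h4, ← Finset.prod_mul_distrib]
    refine Finset.prod_congr rfl fun j _ => ?_
    split_ifs
    · rw [mul_inv_cancel₀ hA]
    · rw [one_mul]

lemma treeTranscript_prod {X A : Type*} [MeasurableSpace X] [Fintype A] [Nonempty A] {n N k : ℕ}
    (label : (j : Fin N) → (Fin (j : ℕ) → A) → Fin n)
    (prob : (j : Fin N) → (Fin (j : ℕ) → A) → X → A → ℝ) (hmeas hnonneg hsum)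
    (hcard : ∀ (y : Fin N → A) (i : Fin n),
      Fintype.card A ^ (Finset.univ.filter fun j => label j (history y j) = i).card = 2 ^ k)
    (x : Fin n → X) (y : Fin N → A) :
    ∏ i, (treeTranscript label prob hmeas hnonneg hsum hcard).f i y (x i) =
      ∏ j, prob j (history y j) (x (label j (history y j))) (y j) := by
  simp only [treeTranscript]
  rw [Finset.prod_comm]
  refine Finset.prod_congr rfl fun j _ => ?_
  simp

/-- A tree of depth `n` over an alphabet of `2 ^ k` letters, in which position `j` belongs to node
`j`. -/
lemma SequentialProtocol.exists_productTranscript {X : Type*} [MeasurableSpace X] {n k : ℕ}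
    (P : SequentialProtocol X n k) :
    ∃ T : ProductTranscript (Fin n) (Fin n → Fin (2 ^ k)) X (2 ^ k),
      P.transcriptProb = fun x y => ∏ i, T.f i y (x i) := by
  refine ⟨treeTranscript (fun j _ => j) (fun j v => (P.q j v).prob)
    (fun j v => (P.q j v).measurable_prob) (fun j v => (P.q j v).prob_nonneg)
    (fun j v => (P.q j v).sum_prob) (fun y i => ?_), ?_⟩
  · simp [Finset.filter_eq']
  · ext x y
    rw [treeTranscript_prod, SequentialProtocol.transcriptProb]

lemma IndependentProtocol.exists_productTranscript {X : Type*} [MeasurableSpace X] {n k : ℕ}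
    (P : IndependentProtocol X n k) :
    ∃ T : ProductTranscript (Fin n) (Fin n → Fin (2 ^ k)) X (2 ^ k),
      P.transcriptProb = fun x y => ∏ i, T.f i y (x i) :=
  SequentialProtocol.exists_productTranscript ⟨fun i _ => P.q i⟩

lemma BlackboardProtocol.exists_productTranscript {X : Type*} [MeasurableSpace X] {n k : ℕ}
    (P : BlackboardProtocol X n k) :
    ∃ T : ProductTranscript (Fin n) (Fin (n * k) → Bool) X (2 ^ k),
      P.transcriptProb = fun x y => ∏ i, T.f i y (x i) := by
  refine ⟨treeTranscript P.label (fun j v x a => if a = true then P.bit j v x else 1 - P.bit j v x)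
    (fun j v a => ?_) (fun j v x a => ?_) (fun j v x => ?_) (fun y i => ?_), ?_⟩
  · split_ifs
    · exact P.measurable_bit j v
    · exact measurable_const.sub (P.measurable_bit j v)
  · have := P.bit_mem j v x
    split_ifs
    · exact this.1
    · exact sub_nonneg.2 this.2
  · simp
  · rw [P.card_label, Fintype.card_bool]
  · ext x y
    rw [treeTranscript_prod, BlackboardProtocol.transcriptProb]

/-! ### Gaussian laws and their densities -/

/-- The product of the centered Gaussian laws with variances `θ j`. -/
def gaussianVec {κ : Type*} [Fintype κ] (θ : κ → ℝ) : Measure (κ → ℝ) :=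
  Measure.pi fun j => gaussianReal 0 (θ j).toNNReal

instance {κ : Type*} [Fintype κ] (θ : κ → ℝ) : IsProbabilityMeasure (gaussianVec θ) := by
  unfold gaussianVec; infer_instance

lemma gaussianDiag_eq_map {d : ℕ} (θ : EuclideanSpace ℝ (Fin d)) (hθ : ∀ i, 0 ≤ θ i) :
    gaussianDiag θ = (gaussianVec θ).map (WithLp.toLp 2) := by
  have : IsProbabilityMeasure ((gaussianVec θ).map (WithLp.toLp 2 : _ → EuclideanSpace ℝ (Fin d))) :=
    Measure.isProbabilityMeasure_map (by fun_prop)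
  unfold gaussianDiag
  refine Measure.ext_of_charFun (E := EuclideanSpace ℝ (Fin d)) ?_
  ext t
  have hpsd : (Matrix.diagonal fun i => θ i).PosSemidef := Matrix.PosSemidef.diagonal hθ
  rw [charFun_multivariateGaussian hpsd, gaussianVec, charFun_pi]
  simp_rw [charFun_gaussianReal, ← Complex.exp_sum]
  congr 1
  simp [Matrix.mulVec_diagonal, dotProduct, Finset.sum_div, Real.coe_toNNReal _ (hθ _)]
  refine Finset.sum_congr rfl fun i _ => ?_
  ring

/-- The density at `x` of the centered Gaussian law with variance `t`. -/
def gaussDensity (t x : ℝ) : ℝ := (√(2 * Real.pi * t))⁻¹ * Real.exp (-x ^ 2 / (2 * t))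

lemma gaussDensity_nonneg (t x : ℝ) : 0 ≤ gaussDensity t x := by
  unfold gaussDensity; positivity

@[fun_prop]
lemma measurable_gaussDensity : Measurable fun p : ℝ × ℝ => gaussDensity p.1 p.2 := by
  unfold gaussDensity; fun_prop

lemma gaussianReal_eq_withDensity {t : ℝ} (ht : 0 < t) :
    gaussianReal 0 t.toNNReal =
      volume.withDensity fun x => ENNReal.ofReal (gaussDensity t x) := by
  rw [gaussianReal_of_var_ne_zero _ (by simpa using ht)]
  congr 1
  ext x
  simp [gaussianPDF, gaussianPDFReal, gaussDensity, Real.coe_toNNReal _ ht.le]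

/-- Checked on boxes, where the indicator of the box factorizes too. It is applied once over
coordinates and once over nodes. -/
lemma pi_withDensity_ofReal {ι X : Type*} [Fintype ι] [MeasurableSpace X] {ν : Measure X}
    [SigmaFinite ν] {μ : ι → Measure X} [∀ i, IsFiniteMeasure (μ i)] {g : ι → X → ℝ}
    (hgm : ∀ i, Measurable (g i)) (hg0 : ∀ i x, 0 ≤ g i x)
    (hμ : ∀ i, μ i = ν.withDensity fun x => ENNReal.ofReal (g i x)) :
    Measure.pi μ =
      (Measure.pi fun _ : ι => ν).withDensity fun x => ENNReal.ofReal (∏ i, g i (x i)) := by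
  classical
  refine Measure.pi_eq fun s hs => ?_
  have hgint (i : ι) : Integrable (g i) ν := by
    refine ⟨(hgm i).aestronglyMeasurable, ?_⟩
    rw [hasFiniteIntegral_iff_ofReal (ae_of_all _ (hg0 i))]
    have := measure_lt_top (μ i) Set.univ
    rwa [hμ i, withDensity_apply _ MeasurableSet.univ, Measure.restrict_univ] at this
  have hind (i : ι) : Integrable ((s i).indicator (g i)) ν := (hgint i).indicator (hs i)
  rw [withDensity_apply _ (MeasurableSet.univ_pi hs), ← lintegral_indicator (MeasurableSet.univ_pi hs)]
  have h1 : (Set.univ.pi s).indicator (fun x : ι → X => ENNReal.ofReal (∏ i, g i (x i))) =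
      fun x => ENNReal.ofReal (∏ i, (s i).indicator (g i) (x i)) := by
    ext x
    by_cases hx : x ∈ Set.univ.pi s
    · rw [Set.indicator_of_mem hx]
      congr 1
      exact Finset.prod_congr rfl fun i _ => (Set.indicator_of_mem (hx i (Set.mem_univ i)) _).symm
    · rw [Set.indicator_of_notMem hx]
      obtain ⟨i, hi⟩ : ∃ i, x i ∉ s i := by simpa [Set.mem_pi] using hx
      rw [Finset.prod_eq_zero (Finset.mem_univ i) (Set.indicator_of_notMem hi _), ENNReal.ofReal_zero]
  have hnn (i : ι) (x : X) : 0 ≤ (s i).indicator (g i) x :=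
    Set.indicator_nonneg (fun x _ => hg0 i x) x
  rw [h1, ← ofReal_integral_eq_lintegral_ofReal (Integrable.fintype_prod hind)
    (ae_of_all _ fun x => Finset.prod_nonneg fun i _ => hnn i (x i)),
    integral_fintype_prod_eq_prod (μ := fun _ : ι => ν),
    ENNReal.ofReal_prod_of_nonneg fun i _ => integral_nonneg (hnn i)]
  refine Finset.prod_congr rfl fun i _ => ?_
  rw [hμ i, withDensity_apply _ (hs i), ← lintegral_indicator (hs i),
    ofReal_integral_eq_lintegral_ofReal (hind i) (ae_of_all _ (hnn i))]
  congr 1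
  ext x
  by_cases hx : x ∈ s i <;> simp [hx]

lemma integral_withDensity_ofReal {X : Type*} [MeasurableSpace X] {ν : Measure X} {g : X → ℝ}
    (hgm : Measurable g) (hg0 : ∀ x, 0 ≤ g x) (h : X → ℝ) :
    ∫ x, h x ∂(ν.withDensity fun x => ENNReal.ofReal (g x)) = ∫ x, g x * h x ∂ν := by
  rw [integral_withDensity_eq_integral_toReal_smul hgm.ennreal_ofReal
    (ae_of_all _ fun x => ENNReal.ofReal_lt_top)]
  simp [ENNReal.toReal_ofReal (hg0 _)]

lemma integrable_withDensity_ofReal {X : Type*} [MeasurableSpace X] {ν : Measure X} {g : X → ℝ}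
    (hgm : Measurable g) (hg0 : ∀ x, 0 ≤ g x) {h : X → ℝ} :
    Integrable h (ν.withDensity fun x => ENNReal.ofReal (g x)) ↔
      Integrable (fun x => g x * h x) ν := by
  rw [integrable_withDensity_iff_integrable_smul' hgm.ennreal_ofReal
    (ae_of_all _ fun x => ENNReal.ofReal_lt_top)]
  simp [ENNReal.toReal_ofReal (hg0 _)]

/-- The joint density of independent samples of `gaussianVec θ`. -/
def sampleDensity {ι κ : Type*} [Fintype ι] [Fintype κ] (θ : κ → ℝ) (x : ι → κ → ℝ) : ℝ :=
  ∏ i, ∏ j, gaussDensity (θ j) (x i j)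

lemma sampleDensity_nonneg {ι κ : Type*} [Fintype ι] [Fintype κ] (θ : κ → ℝ) (x : ι → κ → ℝ) :
    0 ≤ sampleDensity θ x :=
  Finset.prod_nonneg fun _ _ => Finset.prod_nonneg fun _ _ => gaussDensity_nonneg _ _

lemma measurable_gaussDensity_comp {X : Type*} [MeasurableSpace X] {f g : X → ℝ}
    (hf : Measurable f) (hg : Measurable g) : Measurable fun x => gaussDensity (f x) (g x) :=
  measurable_gaussDensity.comp (hf.prodMk hg)

lemma measurable_sampleDensity {ι κ : Type*} [Fintype ι] [Fintype κ] :
    Measurable fun p : (κ → ℝ) × (ι → κ → ℝ) => sampleDensity p.1 p.2 := by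
  unfold sampleDensity
  refine Finset.measurable_prod _ fun i _ => Finset.measurable_prod _ fun j _ => ?_
  exact measurable_gaussDensity_comp (by fun_prop) (by fun_prop)

lemma pi_gaussianVec_eq_withDensity {ι κ : Type*} [Fintype ι] [Fintype κ] {θ : κ → ℝ}
    (hθ : ∀ j, 0 < θ j) :
    (Measure.pi fun _ : ι => gaussianVec θ) =
      (volume : Measure (ι → κ → ℝ)).withDensity fun x => ENNReal.ofReal (sampleDensity θ x) := by
  have h1 : gaussianVec θ =
      (volume : Measure (κ → ℝ)).withDensity fun z =>
        ENNReal.ofReal (∏ j, gaussDensity (θ j) (z j)) :=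
    pi_withDensity_ofReal (ν := (volume : Measure ℝ))
      (μ := fun j => gaussianReal 0 (θ j).toNNReal) (g := fun j => gaussDensity (θ j))
      (fun j => measurable_gaussDensity_comp measurable_const measurable_id)
      (fun j x => gaussDensity_nonneg _ _) fun j => gaussianReal_eq_withDensity (hθ j)
  exact pi_withDensity_ofReal (ν := (volume : Measure (κ → ℝ))) (μ := fun _ : ι => gaussianVec θ)
    (g := fun _ z => ∏ j, gaussDensity (θ j) (z j))
    (fun _ => Finset.measurable_prod _ fun j _ =>
      measurable_gaussDensity_comp measurable_const (measurable_pi_apply j))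
    (fun _ z => Finset.prod_nonneg fun j _ => gaussDensity_nonneg _ _) (fun _ => h1)

lemma integrable_pi_gaussianVec_iff {ι κ : Type*} [Fintype ι] [Fintype κ] {θ : κ → ℝ}
    (hθ : ∀ j, 0 < θ j) (h : (ι → κ → ℝ) → ℝ) :
    Integrable h (Measure.pi fun _ : ι => gaussianVec θ) ↔
      Integrable fun x => sampleDensity θ x * h x := by
  rw [pi_gaussianVec_eq_withDensity hθ]
  exact integrable_withDensity_ofReal
    (measurable_sampleDensity.comp (measurable_const.prodMk measurable_id)) (sampleDensity_nonneg θ)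

lemma integral_pi_gaussianVec {ι κ : Type*} [Fintype ι] [Fintype κ] {θ : κ → ℝ}
    (hθ : ∀ j, 0 < θ j) (h : (ι → κ → ℝ) → ℝ) :
    ∫ x, h x ∂(Measure.pi fun _ : ι => gaussianVec θ) = ∫ x, sampleDensity θ x * h x := by
  rw [pi_gaussianVec_eq_withDensity hθ]
  exact integral_withDensity_ofReal
    (measurable_sampleDensity.comp (measurable_const.prodMk measurable_id)) (sampleDensity_nonneg θ) h

/-! ### The score of the variance parameter -/

/-- The derivative in `t` of the logarithm of `gaussDensity t x`. -/
def varScore (t x : ℝ) : ℝ := (x ^ 2 / t - 1) / (2 * t)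

lemma measurable_varScore_comp {X : Type*} [MeasurableSpace X] {f g : X → ℝ}
    (hf : Measurable f) (hg : Measurable g) : Measurable fun x => varScore (f x) (g x) := by
  unfold varScore; fun_prop

lemma hasDerivAt_gaussDensity {t : ℝ} (ht : 0 < t) (x : ℝ) :
    HasDerivAt (fun t => gaussDensity t x) (gaussDensity t x * varScore t x) t := by
  unfold gaussDensity varScore
  have hpos : 0 < 2 * Real.pi * t := by positivity
  have h1 : HasDerivAt (fun t => (√(2 * Real.pi * t))⁻¹)
      (-(2 * Real.pi / (2 * √(2 * Real.pi * t))) / (√(2 * Real.pi * t)) ^ 2) t := by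
    have := ((hasDerivAt_id t).const_mul (2 * Real.pi)).sqrt hpos.ne'
    have h := this.inv (Real.sqrt_pos.2 hpos).ne'
    simp only [id, mul_one] at h
    exact h
  have h2 : HasDerivAt (fun t => Real.exp (-x ^ 2 / (2 * t)))
      (Real.exp (-x ^ 2 / (2 * t)) * (x ^ 2 / (2 * t ^ 2))) t := by
    have h := ((hasDerivAt_id t).const_mul 2).fun_inv (by positivity : (2 * t : ℝ) ≠ 0)
    have h' := (h.const_mul (-x ^ 2)).exp
    simp only [← div_eq_mul_inv, id] at h'
    convert h' using 1
    field_simp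
  refine (h1.mul h2).congr_deriv ?_
  rw [Real.sq_sqrt hpos.le]
  have := Real.sqrt_pos.2 hpos
  field_simp
  ring

/-- Equivalent to `1 ≤ exp (s + s ^ 2) * (1 - s)`. For `s ≤ 0` the linear bound on `exp` suffices,
as `(1 + s + s ^ 2) * (1 - s) = 1 - s ^ 3`; for `s ≥ 0` the quadratic term is needed. -/
lemma exp_neg_sub_sq_le {s : ℝ} (h2 : s ≤ 1 / 2) :
    Real.exp (-s - s ^ 2) ≤ 1 - s := by
  have h : 1 ≤ Real.exp (s + s ^ 2) * (1 - s) := by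
    rcases le_total 0 s with hs | hs
    · have := Real.quadratic_le_exp_of_nonneg (by positivity : 0 ≤ s + s ^ 2)
      have h3 : 1 ≤ (1 + (s + s ^ 2) + (s + s ^ 2) ^ 2 / 2) * (1 - s) := by
        have : 0 ≤ s ^ 2 * (1 - s - s ^ 2 - s ^ 3) := by
          refine mul_nonneg (sq_nonneg _) ?_
          nlinarith [mul_nonneg hs hs, mul_nonneg hs (sub_nonneg.2 h2),
            mul_nonneg (mul_nonneg hs hs) (sub_nonneg.2 h2)]
        nlinarith
      exact h3.trans (mul_le_mul_of_nonneg_right this (by linarith))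
    · have := Real.add_one_le_exp (s + s ^ 2)
      have h3 : 1 ≤ (s + s ^ 2 + 1) * (1 - s) := by nlinarith [pow_nonneg (neg_nonneg.2 hs) 3]
      exact h3.trans (mul_le_mul_of_nonneg_right this (by linarith))
  calc Real.exp (-s - s ^ 2) ≤ Real.exp (-s - s ^ 2) * (Real.exp (s + s ^ 2) * (1 - s)) :=
        le_mul_of_one_le_right (Real.exp_pos _).le h
    _ = 1 - s := by
      rw [← mul_assoc, ← Real.exp_add, show -s - s ^ 2 + (s + s ^ 2) = 0 by ring, Real.exp_zero,
        one_mul]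

/-- The tilted density is Gaussian again, so the moment is exactly `exp (-s) / √(1 - 2 * s)`; the
estimate `exp_neg_sub_sq_le` at `2 * s` bounds the denominator. -/
lemma exp_chiSq_moment {t s : ℝ} (ht : 0 < t) (hs : |s| ≤ 1 / 4) :
    Integrable (fun x => Real.exp (s * (x ^ 2 / t - 1))) (gaussianReal 0 t.toNNReal) ∧
      ∫ x, Real.exp (s * (x ^ 2 / t - 1)) ∂(gaussianReal 0 t.toNNReal) ≤ Real.exp (2 * s ^ 2) := by
  obtain ⟨hs1, hs2⟩ := abs_le.1 hs
  have hm : Measurable fun x => gaussDensity t x :=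
    measurable_gaussDensity_comp measurable_const measurable_id
  have hb : 0 < (1 / 2 - s) / t := div_pos (by linarith) ht
  have e : (fun x => gaussDensity t x * Real.exp (s * (x ^ 2 / t - 1))) = fun x =>
      ((√(2 * Real.pi * t))⁻¹ * Real.exp (-s)) * Real.exp (-((1 / 2 - s) / t) * x ^ 2) := by
    ext x
    rw [gaussDensity, mul_assoc, mul_assoc ((√(2 * Real.pi * t))⁻¹), ← Real.exp_add, ← Real.exp_add]
    congr 2
    field_simp
    ring
  rw [gaussianReal_eq_withDensity ht, integrable_withDensity_ofReal hm (gaussDensity_nonneg t),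
    integral_withDensity_ofReal hm (gaussDensity_nonneg t), e]
  refine ⟨(integrable_exp_neg_mul_sq hb).const_mul _, ?_⟩
  rw [integral_const_mul, integral_gaussian]
  have h1 : √(Real.pi / ((1 / 2 - s) / t)) = √(2 * Real.pi * t) * (√(1 - 2 * s))⁻¹ := by
    rw [← Real.sqrt_inv, ← Real.sqrt_mul (by positivity)]
    congr 1
    have : (1 / 2 - s) ≠ 0 := by linarith
    have : (1 - 2 * s) ≠ 0 := by linarith
    field_simp
  rw [h1]
  have h2 := Real.sqrt_pos.2 (by positivity : 0 < 2 * Real.pi * t)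
  have h3 : Real.exp (-s - 2 * s ^ 2) ≤ √(1 - 2 * s) := by
    refine Real.le_sqrt_of_sq_le ?_
    have := exp_neg_sub_sq_le (s := 2 * s) (by linarith)
    rw [← Real.exp_nat_mul]
    convert this using 2
    push_cast
    ring
  have h4 : 0 < √(1 - 2 * s) := (Real.exp_pos _).trans_le h3
  calc _ = Real.exp (-s) / √(1 - 2 * s) := by field_simp
    _ ≤ Real.exp (-s) / Real.exp (-s - 2 * s ^ 2) := by gcongr
    _ = _ := by rw [← Real.exp_sub]; congr 1; ring

lemma integral_varScore {t : ℝ} (ht : 0 < t) :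
    ∫ x, varScore t x ∂(gaussianReal 0 t.toNNReal) = 0 := by
  have h1 : ∫ x, x ^ 2 ∂(gaussianReal 0 t.toNNReal) = t := by
    have := variance_of_integral_eq_zero (X := fun x : ℝ => x) (μ := gaussianReal 0 t.toNNReal)
      (by fun_prop) (by simp)
    simpa [Real.coe_toNNReal _ ht.le] using this.symm
  have h2 : Integrable (fun x : ℝ => x ^ 2) (gaussianReal 0 t.toNNReal) :=
    (memLp_id_gaussianReal 2).integrable_sq
  unfold varScore
  rw [integral_div, integral_sub (h2.div_const t) (integrable_const 1), integral_div, h1]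
  simp [ht.ne']

theorem isSubexpScore_gaussianVec {κ : Type*} [Fintype κ] {θ : κ → ℝ} {m : ℝ} (hm : 0 < m)
    (hθ : ∀ j, m ≤ θ j) :
    IsSubexpScore (gaussianVec θ) (fun j z => varScore (θ j) (z j)) (m / 2) := by
  have hpos (j : κ) : 0 < θ j := hm.trans_le (hθ j)
  have hs (u : κ → ℝ) (hu : ∑ j, u j ^ 2 ≤ 1) (j : κ) :
      |m / 2 * u j / (2 * θ j)| ≤ 1 / 4 * |u j| := by
    rw [abs_div, abs_mul, abs_of_pos (by positivity : 0 < m / 2),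
      abs_of_pos (by have := hpos j; positivity : 0 < 2 * θ j), div_le_iff₀ (by have := hpos j; positivity)]
    nlinarith [mul_le_mul_of_nonneg_right (hθ j) (abs_nonneg (u j))]
  have hu1 (u : κ → ℝ) (hu : ∑ j, u j ^ 2 ≤ 1) (j : κ) : |u j| ≤ 1 := by
    rw [← sq_le_one_iff_abs_le_one]
    exact (Finset.single_le_sum (fun i _ => sq_nonneg (u i)) (Finset.mem_univ j)).trans hu
  have hs' (u : κ → ℝ) (hu : ∑ j, u j ^ 2 ≤ 1) (j : κ) : |m / 2 * u j / (2 * θ j)| ≤ 1 / 4 := by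
    linarith [hs u hu j, hu1 u hu j]
  have he (u : κ → ℝ) : (fun z : κ → ℝ => Real.exp (m / 2 * ∑ j, u j * varScore (θ j) (z j))) =
      fun z => ∏ j, Real.exp (m / 2 * u j / (2 * θ j) * (z j ^ 2 / θ j - 1)) := by
    ext z
    rw [← Real.exp_sum, Finset.mul_sum]
    congr 1
    refine Finset.sum_congr rfl fun j _ => ?_
    unfold varScore
    ring
  refine ⟨fun j => measurable_varScore_comp measurable_const (by fun_prop), fun j => ?_,
    fun u hu => ?_, fun u hu => ?_⟩
  · rw [gaussianVec, integral_comp_eval (μ := fun j => gaussianReal 0 (θ j).toNNReal)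
      (f := varScore (θ j))
      (measurable_varScore_comp measurable_const measurable_id).aestronglyMeasurable,
      integral_varScore (hpos j)]
  · rw [he]
    exact Integrable.fintype_prod fun j => (exp_chiSq_moment (hpos j) (hs' u hu j)).1
  · simp_rw [he]
    rw [gaussianVec, integral_fintype_prod_eq_prod (μ := fun j => gaussianReal 0 (θ j).toNNReal)
      (fun j x => Real.exp (m / 2 * u j / (2 * θ j) * (x ^ 2 / θ j - 1)))]
    calc _ ≤ ∏ j, Real.exp (2 * (m / 2 * u j / (2 * θ j)) ^ 2) :=
          Finset.prod_le_prod (fun j _ => integral_nonneg fun x => (Real.exp_pos _).le)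
            fun j _ => (exp_chiSq_moment (hpos j) (hs' u hu j)).2
      _ = Real.exp (∑ j, 2 * (m / 2 * u j / (2 * θ j)) ^ 2) := (Real.exp_sum _ _).symm
      -- Each coefficient is at most `|u j| / 4` because `m ≤ θ j`, so the exponent is dominated by
      -- half of `∑ j, u j ^ 2`, uniformly in the dimension.
      _ ≤ Real.exp (1 / 2) := by
        refine Real.exp_le_exp.2 ?_
        calc _ ≤ ∑ j, 1 / 2 * u j ^ 2 := by
              refine Finset.sum_le_sum fun j _ => ?_
              have := pow_le_pow_left₀ (abs_nonneg _) (hs u hu j) 2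
              rw [mul_pow, sq_abs, sq_abs] at this
              nlinarith [sq_nonneg (u j)]
          _ = 1 / 2 * ∑ j, u j ^ 2 := (Finset.mul_sum _ _ _).symm
          _ ≤ _ := by linarith
      _ ≤ 2 := by
        have h1 : Real.exp (1 / 2) ^ 2 = Real.exp 1 := by
          rw [← Real.exp_nat_mul]; norm_num
        have h2 := Real.exp_one_lt_d9
        nlinarith [Real.exp_pos (1 / 2)]

/-! ### The uniform prior and the test function -/

/-- The uniform distribution on `[a, b]`. -/
def unifIcc (a b : ℝ) : Measure ℝ := ProbabilityTheory.cond volume (Set.Icc a b)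

lemma isProbabilityMeasure_unifIcc {a b : ℝ} (hab : a < b) :
    IsProbabilityMeasure (unifIcc a b) :=
  cond_isProbabilityMeasure_of_finite (by simp [hab]) (by simp)

lemma integral_unifIcc {a b : ℝ} (hab : a < b) (h : ℝ → ℝ) :
    ∫ t, h t ∂(unifIcc a b) = (b - a)⁻¹ * ∫ t in a..b, h t := by
  rw [unifIcc, ProbabilityTheory.cond, integral_smul_measure, Real.volume_Icc,
    intervalIntegral.integral_of_le hab.le, integral_Icc_eq_integral_Ioc, ENNReal.toReal_inv,
    ENNReal.toReal_ofReal (by linarith), smul_eq_mul]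

lemma ae_unifIcc (a b : ℝ) : ∀ᵐ t ∂(unifIcc a b), t ∈ Set.Icc a b :=
  ae_cond_mem measurableSet_Icc

/-- Resampling one coordinate preserves a product probability measure. -/
lemma measurePreserving_update {κ : Type*} [Fintype κ] [DecidableEq κ] (U : Measure ℝ)
    [IsProbabilityMeasure U] (j : κ) :
    MeasurePreserving (fun p : (κ → ℝ) × ℝ => Function.update p.1 j p.2)
      ((Measure.pi fun _ : κ => U).prod U) (Measure.pi fun _ : κ => U) := by
  have hm : Measurable fun p : (κ → ℝ) × ℝ => Function.update p.1 j p.2 := by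
    refine measurable_pi_lambda _ fun l => ?_
    by_cases h : l = j
    · subst h; simpa using measurable_snd
    · simp only [Function.update_of_ne h]; fun_prop
  refine ⟨hm, Eq.symm (Measure.pi_eq fun s hs => ?_)⟩
  rw [Measure.map_apply hm (MeasurableSet.univ_pi hs)]
  have h1 : (fun p : (κ → ℝ) × ℝ => Function.update p.1 j p.2) ⁻¹' Set.univ.pi s =
      (Set.univ.pi fun l => if l = j then Set.univ else s l) ×ˢ s j := by
    ext ⟨θ, t⟩
    simp only [Set.mem_preimage, Set.mem_pi, Set.mem_univ, true_imp_iff, Set.mem_prod]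
    constructor
    · intro h
      refine ⟨fun l => ?_, by simpa using h j⟩
      split_ifs with hl
      · trivial
      · simpa [Function.update_of_ne hl] using h l
    · rintro ⟨h, hj⟩ l
      by_cases hl : l = j
      · subst hl; simpa using hj
      · simpa [Function.update_of_ne hl, hl] using h l
  rw [h1, Measure.prod_prod, Measure.pi_pi]
  have h2 (l : κ) : U (if l = j then Set.univ else s l) = if l = j then 1 else U (s l) := by
    split_ifs <;> simp
  simp_rw [h2]
  have h3 : U (s j) = ∏ l, if l = j then U (s l) else 1 := by simp
  rw [h3, ← Finset.prod_mul_distrib]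
  exact Finset.prod_congr rfl fun l _ => by split_ifs <;> simp

/-- Resample coordinate `j` and apply Fubini. No integrability is assumed, since the integral of a
non-integrable function is `0` by convention. -/
lemma integral_pi_eq_zero_of_coordinate {κ : Type*} [Fintype κ] [DecidableEq κ] (U : Measure ℝ)
    [IsProbabilityMeasure U] (j : κ) (h : (κ → ℝ) → ℝ)
    (h0 : ∀ θ, ∫ t, h (Function.update θ j t) ∂U = 0) :
    ∫ θ, h θ ∂(Measure.pi fun _ : κ => U) = 0 := by
  by_cases hi : Integrable h (Measure.pi fun _ : κ => U)
  · have hp := measurePreserving_update U j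
    have hi' := hp.integrable_comp_of_integrable hi
    rw [← hp.map_eq, integral_map hp.aemeasurable (by rw [hp.map_eq]; exact hi.1),
      integral_prod (fun p : (κ → ℝ) × ℝ => h (Function.update p.1 j p.2)) hi']
    simp [h0]
  · exact integral_undef hi

/-- The weight vanishing at the endpoints of `[a, b]` used as a test function. -/
def bump (a b t : ℝ) : ℝ := (t - a) * (b - t)

lemma hasDerivAt_bump (a b t : ℝ) : HasDerivAt (bump a b) (a + b - 2 * t) t := by
  unfold bump
  refine (((hasDerivAt_id t).sub_const a).mul ((hasDerivAt_id t).const_sub b)).congr_deriv ?_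
  simp; ring

lemma bump_nonneg {a b t : ℝ} (ht : t ∈ Set.Icc a b) : 0 ≤ bump a b t :=
  mul_nonneg (sub_nonneg.2 ht.1) (sub_nonneg.2 ht.2)

lemma bump_le {a b t : ℝ} : bump a b t ≤ (b - a) ^ 2 / 4 := by
  unfold bump; nlinarith [sq_nonneg (a + b - 2 * t)]

lemma abs_bump_deriv_le {a b t : ℝ} (ht : t ∈ Set.Icc a b) : |a + b - 2 * t| ≤ b - a :=
  abs_le.2 ⟨by linarith [ht.2], by linarith [ht.1]⟩

lemma integral_bump {a b : ℝ} (hab : a < b) :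
    ∫ t, bump a b t ∂(unifIcc a b) = (b - a) ^ 2 / 6 := by
  rw [integral_unifIcc hab]
  have h (t : ℝ) : HasDerivAt (fun t => (a + b) / 2 * t ^ 2 - t ^ 3 / 3 - a * b * t)
      (bump a b t) t := by
    have h1 := ((hasDerivAt_pow 2 t).const_mul ((a + b) / 2))
    have h2 := ((hasDerivAt_pow 3 t).div_const 3)
    have h3 := ((hasDerivAt_id t).const_mul (a * b))
    refine ((h1.sub h2).sub h3).congr_deriv ?_
    unfold bump
    norm_num
    ring
  rw [intervalIntegral.integral_eq_sub_of_hasDerivAt (fun t _ => h t)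
    (Continuous.intervalIntegrable (by unfold bump; fun_prop) _ _)]
  have : b - a ≠ 0 := by linarith
  field_simp
  ring

/-- The factor multiplying the density in the derivative of
`t ↦ (c - t) * bump a b t * ∏ i, gaussDensity t (z i)`. -/
def testFactor {ι : Type*} [Fintype ι] (a b c t : ℝ) (z : ι → ℝ) : ℝ :=
  (c - t) * (bump a b t * ∑ i, varScore t (z i) + (a + b - 2 * t)) - bump a b t

/-- The integrand is the derivative of a function that vanishes at both endpoints because `bump`
does. -/
lemma integral_testFactor_mul {ι : Type*} [Fintype ι] {a b : ℝ} (ha : 0 < a) (hab : a < b) (c : ℝ)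
    (z : ι → ℝ) :
    ∫ t, testFactor a b c t z * ∏ i, gaussDensity t (z i) ∂(unifIcc a b) = 0 := by
  classical
  rw [integral_unifIcc hab]
  have hprod {t : ℝ} (ht : 0 < t) : HasDerivAt (fun t => ∏ i, gaussDensity t (z i))
      ((∏ i, gaussDensity t (z i)) * ∑ i, varScore t (z i)) t := by
    refine (HasDerivAt.fun_finsetProd (u := Finset.univ) fun i _ =>
      hasDerivAt_gaussDensity ht (z i)).congr_deriv ?_
    rw [Finset.mul_sum]
    refine Finset.sum_congr rfl fun i _ => ?_
    rw [smul_eq_mul, ← mul_assoc, Finset.prod_erase_mul _ _ (Finset.mem_univ i)]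
  have hpos {t : ℝ} (ht : t ∈ Set.uIcc a b) : 0 < t := by
    rw [Set.uIcc_of_le hab.le] at ht; exact ha.trans_le ht.1
  have hder (t : ℝ) (ht : t ∈ Set.uIcc a b) :
      HasDerivAt (fun t => (c - t) * bump a b t * ∏ i, gaussDensity t (z i))
        (testFactor a b c t z * ∏ i, gaussDensity t (z i)) t := by
    refine ((((hasDerivAt_id t).const_sub c).mul (hasDerivAt_bump a b t)).mul
      (hprod (hpos ht))).congr_deriv ?_
    simp only [testFactor, id, Pi.mul_apply]
    ring
  have hcont : ContinuousOn (fun t => testFactor a b c t z * ∏ i, gaussDensity t (z i))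
      (Set.uIcc a b) := by
    refine ContinuousOn.mul ?_ fun t ht => (hprod (hpos ht)).continuousAt.continuousWithinAt
    unfold testFactor bump varScore
    have h2 : ∀ t ∈ Set.uIcc a b, 2 * t ≠ 0 := fun t ht => by have := hpos ht; positivity
    have h1 : ∀ t ∈ Set.uIcc a b, t ≠ 0 := fun t ht => (hpos ht).ne'
    refine ContinuousOn.sub (ContinuousOn.mul (by fun_prop) (ContinuousOn.add
      (ContinuousOn.mul (by fun_prop) ?_) (by fun_prop))) (by fun_prop)
    refine continuousOn_finsetSum _ fun i _ => ?_
    exact ContinuousOn.div (ContinuousOn.sub (ContinuousOn.div (by fun_prop) (by fun_prop) h1)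
      (by fun_prop)) (by fun_prop) h2
  rw [intervalIntegral.integral_eq_sub_of_hasDerivAt hder hcont.intervalIntegrable]
  simp [bump]

lemma abs_prod_f_mul_testFactor_le {ι κ Y : Type*} [Fintype ι] [DecidableEq ι] [Fintype Y]
    {K : ℝ} {T : ProductTranscript ι Y (κ → ℝ) K} {a b c : ℝ}
    {j : κ} {y : Y} {t : ℝ} (ht : t ∈ Set.Icc a b)
    (x : ι → κ → ℝ) :
    |(∏ i, T.f i y (x i)) * testFactor a b c t fun i => x i j| ≤
      (|c| + |a| + |b|) * ((b - a) ^ 2 * ∑ i, |varScore t (x i j)| + (b - a)) + (b - a) ^ 2 := by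
  have h1 : |∏ i, T.f i y (x i)| ≤ 1 := by
    rw [abs_of_nonneg (Finset.prod_nonneg fun i _ => T.nonneg_f i y _)]
    exact Finset.prod_le_one (fun i _ => T.nonneg_f i y _) fun i _ => T.le_one_f i y _
  have h2 := bump_nonneg ht
  have h3 : bump a b t ≤ (b - a) ^ 2 := bump_le.trans (by nlinarith [sq_nonneg (b - a)])
  have h4 := abs_bump_deriv_le ht
  have h5 : |c - t| ≤ |c| + |a| + |b| := by
    have : |t| ≤ |a| + |b| := by
      refine (abs_le_max_abs_abs ht.1 ht.2).trans (max_le ?_ ?_) <;>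
      linarith [abs_nonneg a, abs_nonneg b]
    linarith [abs_sub c t]
  rw [abs_mul]
  refine (mul_le_of_le_one_left (abs_nonneg _) h1).trans ?_
  unfold testFactor
  refine (abs_sub _ _).trans (add_le_add ?_ (by rwa [abs_of_nonneg h2]))
  rw [abs_mul]
  refine mul_le_mul h5 ((abs_add_le _ _).trans (add_le_add ?_ h4)) (abs_nonneg _) (by positivity)
  rw [abs_mul, abs_of_nonneg h2]
  exact mul_le_mul h3 (Finset.abs_sum_le_sum_abs _ _) (abs_nonneg _) (by positivity)

lemma integrable_varScore_eval {ι κ : Type*} [Fintype ι] [Fintype κ] 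
    {a b : ℝ} {θ : κ → ℝ} (ha : 0 < a) (hθ : ∀ j, θ j ∈ Set.Icc a b) (i : ι)
    (j : κ) :
    Integrable (fun x : ι → κ → ℝ => varScore (θ j) (x i j))
      (Measure.pi fun _ : ι => gaussianVec θ) :=
  integrable_comp_eval (μ := fun _ : ι => gaussianVec θ) (f := fun z => varScore (θ j) (z j))
    ((isSubexpScore_gaussianVec ha fun j => (hθ j).1).integrable (by positivity) j)

/-! ### Integration by parts and the van Trees type inequality -/

section VanTrees

variable {ι κ Y : Type*} [Fintype ι] [DecidableEq ι] [Fintype κ] [Fintype Y]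
  {K : ℝ} (T : ProductTranscript ι Y (κ → ℝ) K) {a b : ℝ}

/-- The integrand of the integration by parts identity. -/
def testIntegrand (a b c : ℝ) (j : κ) (y : Y) (θ : κ → ℝ) (x : ι → κ → ℝ) : ℝ :=
  sampleDensity θ x * ((∏ i, T.f i y (x i)) * testFactor a b c (θ j) fun i => x i j)

lemma measurable_testIntegrand (a b c : ℝ) (j : κ) (y : Y) :
    Measurable fun p : (κ → ℝ) × (ι → κ → ℝ) => testIntegrand T a b c j y p.1 p.2 := by
  unfold testIntegrand testFactor bump
  refine measurable_sampleDensity.mul ((Finset.measurable_prod _ fun i _ =>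
    (T.measurable_f i y).comp (by fun_prop)).mul ?_)
  have h : Measurable fun p : (κ → ℝ) × (ι → κ → ℝ) => ∑ i, varScore (p.1 j) (p.2 i j) :=
    Finset.measurable_sum _ fun i _ => measurable_varScore_comp (by fun_prop) (by fun_prop)
  fun_prop

/-- With the samples fixed, only the `j`-th densities depend on `θ j`; everything else comes out of
the one-dimensional integration by parts. -/
lemma integral_testIntegrand_prior (ha : 0 < a) (hab : a < b) (c : ℝ) (j : κ) (y : Y)
    (x : ι → κ → ℝ) :
    ∫ θ, testIntegrand T a b c j y θ x ∂(Measure.pi fun _ : κ => unifIcc a b) = 0 := by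
  classical
  have := isProbabilityMeasure_unifIcc hab
  refine integral_pi_eq_zero_of_coordinate _ j _ fun θ => ?_
  have e (t : ℝ) : testIntegrand T a b c j y (Function.update θ j t) x =
      ((∏ i, T.f i y (x i)) * ∏ i, ∏ l, if l = j then 1 else gaussDensity (θ l) (x i l)) *
        (testFactor a b c t (fun i => x i j) * ∏ i, gaussDensity t (x i j)) := by
    have h : sampleDensity (Function.update θ j t) x =
        (∏ i, ∏ l, if l = j then 1 else gaussDensity (θ l) (x i l)) *
          ∏ i, gaussDensity t (x i j) := by
      unfold sampleDensity
      rw [← Finset.prod_mul_distrib]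
      refine Finset.prod_congr rfl fun i _ => ?_
      have : gaussDensity t (x i j) = ∏ l, if l = j then gaussDensity t (x i l) else 1 := by simp
      rw [this, ← Finset.prod_mul_distrib]
      refine Finset.prod_congr rfl fun l _ => ?_
      by_cases hl : l = j
      · subst hl; simp
      · simp [hl]
    rw [testIntegrand, h, Function.update_self]
    ring
  simp_rw [e]
  rw [integral_const_mul, integral_testFactor_mul ha hab, mul_zero]

variable {T}

lemma integrable_prod_f_mul_varScore {θ : κ → ℝ} (ha : 0 < a) (hθ : ∀ j, θ j ∈ Set.Icc a b)
    (j : κ) (y : Y) :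
    Integrable (fun x : ι → κ → ℝ => (∏ i, T.f i y (x i)) * ∑ i, varScore (θ j) (x i j))
      (Measure.pi fun _ : ι => gaussianVec θ) := by
  refine (integrable_finsetSum _ fun i _ => integrable_varScore_eval ha hθ i j).bdd_mul
    (c := 1) (Finset.measurable_prod _ fun i _ =>
      (T.measurable_f i y).comp (measurable_pi_apply i)).aestronglyMeasurable
    (ae_of_all _ fun x => ?_)
  rw [Real.norm_of_nonneg (Finset.prod_nonneg fun i _ => T.nonneg_f i y _)]
  exact Finset.prod_le_one (fun i _ => T.nonneg_f i y _) fun i _ => T.le_one_f i y _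

lemma integral_testIntegrand {θ : κ → ℝ} (ha : 0 < a) (hθ : ∀ j, θ j ∈ Set.Icc a b) (c : ℝ)
    (j : κ) (y : Y) :
    Integrable (testIntegrand T a b c j y θ) ∧ ∫ x, testIntegrand T a b c j y θ x =
      (c - θ j) * (bump a b (θ j) * T.score (gaussianVec θ) (fun z => varScore (θ j) (z j)) y +
        (a + b - 2 * θ j) * T.lik (gaussianVec θ) y) - bump a b (θ j) * T.lik (gaussianVec θ) y := by
  have hpos (j : κ) : 0 < θ j := ha.trans_le (hθ j).1
  have i1 := integrable_prod_f_mul_varScore (T := T) ha hθ j y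
  have i2 : Integrable (fun x : ι → κ → ℝ => ∏ i, T.f i y (x i))
      (Measure.pi fun _ : ι => gaussianVec θ) :=
    Integrable.fintype_prod fun i => T.integrable_f _ i y
  have e : (fun x : ι → κ → ℝ => (∏ i, T.f i y (x i)) * testFactor a b c (θ j) fun i => x i j) =
      fun x => ((c - θ j) * bump a b (θ j)) * ((∏ i, T.f i y (x i)) * ∑ i, varScore (θ j) (x i j)) +
        ((c - θ j) * (a + b - 2 * θ j) - bump a b (θ j)) * ∏ i, T.f i y (x i) := by
    ext x
    simp only [testFactor]
    ring
  set h : (ι → κ → ℝ) → ℝ :=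
    fun x => (∏ i, T.f i y (x i)) * testFactor a b c (θ j) fun i => x i j
  change Integrable (fun x => sampleDensity θ x * h x) ∧ ∫ x, sampleDensity θ x * h x = _
  rw [← integrable_pi_gaussianVec_iff hpos, ← integral_pi_gaussianVec hpos, e]
  refine ⟨(i1.const_mul _).add (i2.const_mul _), ?_⟩
  rw [integral_add (i1.const_mul _) (i2.const_mul _), integral_const_mul, integral_const_mul,
    T.integral_prod_f, ProductTranscript.score]
  ring

lemma integral_abs_testIntegrand_le {θ : κ → ℝ} (ha : 0 < a) (hθ : ∀ j, θ j ∈ Set.Icc a b) (c : ℝ)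
    (j : κ) (y : Y) :
    ∫ x, |testIntegrand T a b c j y θ x| ≤
      (|c| + |a| + |b|) * ((b - a) ^ 2 * (Fintype.card ι * (1 + 4 / (a / 2) ^ 2)) + (b - a)) +
        (b - a) ^ 2 := by
  have hpos (j : κ) : 0 < θ j := ha.trans_le (hθ j).1
  have hsub := isSubexpScore_gaussianVec ha fun j => (hθ j).1
  have i0 := (integral_testIntegrand (T := T) ha hθ c j y).1
  set h : (ι → κ → ℝ) → ℝ :=
    fun x => (∏ i, T.f i y (x i)) * testFactor a b c (θ j) fun i => x i j
  have e : (fun x => |testIntegrand T a b c j y θ x|) = fun x => sampleDensity θ x * |h x| := by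
    ext x
    rw [testIntegrand, abs_mul, abs_of_nonneg (sampleDensity_nonneg θ x)]
  change Integrable (fun x => sampleDensity θ x * h x) at i0
  rw [← integrable_pi_gaussianVec_iff hpos] at i0
  rw [e, ← integral_pi_gaussianVec hpos]
  have i1 : Integrable (fun x : ι → κ → ℝ => ∑ i, |varScore (θ j) (x i j)|)
      (Measure.pi fun _ : ι => gaussianVec θ) :=
    integrable_finsetSum _ fun i _ => (integrable_varScore_eval ha hθ i j).abs
  have i2 := ((((i1.const_mul ((b - a) ^ 2)).add (integrable_const (b - a))).const_mul
    (|c| + |a| + |b|)).add (integrable_const ((b - a) ^ 2)))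
  refine (integral_mono i0.abs i2 fun x => abs_prod_f_mul_testFactor_le (hθ j) x).trans ?_
  have hba : 0 ≤ b - a := by linarith [(hθ j).1, (hθ j).2]
  have h1 : ∫ x, ∑ i, |varScore (θ j) (x i j)| ∂(Measure.pi fun _ : ι => gaussianVec θ) ≤
      Fintype.card ι * (1 + 4 / (a / 2) ^ 2) := by
    rw [integral_finsetSum _ fun i _ => (integrable_varScore_eval ha hθ i j).abs]
    calc _ ≤ ∑ _i : ι, (1 + 4 / (a / 2) ^ 2) := by
          refine Finset.sum_le_sum fun i _ => ?_
          rw [integral_comp_eval (μ := fun _ : ι => gaussianVec θ)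
            (f := fun z => |varScore (θ j) (z j)|)
            (hsub.integrable (by positivity) j).abs.aestronglyMeasurable]
          exact hsub.integral_abs_le (by positivity) j
      _ = _ := by simp; ring
  have h2 := integral_add' (((i1.const_mul ((b - a) ^ 2)).add (integrable_const (b - a))).const_mul
    (|c| + |a| + |b|)) (integrable_const ((b - a) ^ 2))
  rw [h2, integral_const_mul, integral_add' (i1.const_mul _) (integrable_const _),
    integral_const_mul]
  simp only [integral_const, probReal_univ, one_smul]
  gcongr

lemma ae_prior (a b : ℝ) (hab : a < b) :
    ∀ᵐ θ ∂(Measure.pi fun _ : κ => unifIcc a b), ∀ j, θ j ∈ Set.Icc a b := by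
  have := isProbabilityMeasure_unifIcc hab
  exact Filter.eventually_all.2 fun j =>
    (Measure.tendsto_eval_ae_ae (μ := fun _ : κ => unifIcc a b)).eventually (ae_unifIcc a b)

/-- Licenses Fubini between prior and samples: the inner `L¹` norm is bounded uniformly on the cube,
and the prior is a probability measure. -/
lemma integrable_testIntegrand_prod (ha : 0 < a) (hab : a < b) (c : ℝ) (j : κ) (y : Y) :
    Integrable (Function.uncurry (testIntegrand T a b c j y))
      ((Measure.pi fun _ : κ => unifIcc a b).prod volume) := by
  have := isProbabilityMeasure_unifIcc hab
  have hm : AEStronglyMeasurable (Function.uncurry (testIntegrand T a b c j y))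
      ((Measure.pi fun _ : κ => unifIcc a b).prod volume) :=
    (measurable_testIntegrand T a b c j y).aestronglyMeasurable
  rw [integrable_prod_iff hm]
  refine ⟨(ae_prior a b hab).mono fun θ hθ => (integral_testIntegrand ha hθ c j y).1, ?_⟩
  refine Integrable.of_bound (C := (|c| + |a| + |b|) *
      ((b - a) ^ 2 * (Fintype.card ι * (1 + 4 / (a / 2) ^ 2)) + (b - a)) + (b - a) ^ 2)
    hm.norm.integral_prod_right' ((ae_prior a b hab).mono fun θ hθ => ?_)
  rw [Real.norm_of_nonneg (integral_nonneg fun x => norm_nonneg _)]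
  exact integral_abs_testIntegrand_le ha hθ c j y

lemma integral_integral_testIntegrand (ha : 0 < a) (hab : a < b) (c : ℝ) (j : κ) (y : Y) :
    ∫ θ, (∫ x, testIntegrand T a b c j y θ x) ∂(Measure.pi fun _ : κ => unifIcc a b) = 0 := by
  have := isProbabilityMeasure_unifIcc hab
  rw [integral_integral_swap (integrable_testIntegrand_prod ha hab c j y)]
  simp [integral_testIntegrand_prior T ha hab]

lemma sum_sum_abs_mul_lik_le (μ : Measure (κ → ℝ)) [IsProbabilityMeasure μ] (c : Y → κ → ℝ) :
    ∑ y, ∑ j, |c y j| * T.lik μ y ≤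
      √(∑ y, T.lik μ y * ∑ j, c y j ^ 2) * √(Fintype.card κ) := by
  have h1 : ∑ y, ∑ j, |c y j| * T.lik μ y = ∑ p : Y × κ,
      (√(T.lik μ p.1) * |c p.1 p.2|) * √(T.lik μ p.1) := by
    rw [Fintype.sum_prod_type]
    refine Finset.sum_congr rfl fun y _ => Finset.sum_congr rfl fun j _ => ?_
    linear_combination (-|c y j|) * Real.mul_self_sqrt (T.lik_nonneg μ y)
  have h2 : ∑ y, T.lik μ y * ∑ j, c y j ^ 2 =
      ∑ p : Y × κ, (√(T.lik μ p.1) * |c p.1 p.2|) ^ 2 := by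
    rw [Fintype.sum_prod_type]
    refine Finset.sum_congr rfl fun y _ => ?_
    rw [Finset.mul_sum]
    refine Finset.sum_congr rfl fun j _ => ?_
    rw [mul_pow, Real.sq_sqrt (T.lik_nonneg μ y), sq_abs]
  have h3 : (Fintype.card κ : ℝ) = ∑ p : Y × κ, √(T.lik μ p.1) ^ 2 := by
    rw [Fintype.sum_prod_type, Finset.sum_comm]
    simp_rw [Real.sq_sqrt (T.lik_nonneg μ _)]
    simp [T.sum_lik]
  rw [h1, h2, h3]
  exact Real.sum_mul_le_sqrt_mul_sqrt _ _ _

/-- The risk bound holds at every `θ` of the cube, so Cauchy–Schwarz is used pointwise in `θ` and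
only over transcripts and coordinates. The subtracted weight comes from differentiating the error `c
- θ j`. -/
lemma sum_sum_integral_testIntegrand_le {θ : κ → ℝ} (ha : 0 < a) (hab : a < b)
    (hθ : ∀ j, θ j ∈ Set.Icc a b) (c : Y → κ → ℝ) {R J : ℝ}
    (hR : ∑ y, T.lik (gaussianVec θ) y * ∑ j, (c y j - θ j) ^ 2 ≤ R)
    (hJ : ∑ j, ∑ y, T.score (gaussianVec θ) (fun z => varScore (θ j) (z j)) y ^ 2 /
      T.lik (gaussianVec θ) y ≤ J) :
    ∑ y, ∑ j, ∫ x, testIntegrand T a b (c y j) j y θ x ≤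
      √R * ((b - a) ^ 2 / 4 * √J + (b - a) * √(Fintype.card κ)) - ∑ j, bump a b (θ j) := by
  have hsub := isSubexpScore_gaussianVec ha fun j => (hθ j).1
  have h1 := T.sum_sum_abs_mul_score_le hsub (by positivity) fun y j => c y j - θ j
  have h2 := sum_sum_abs_mul_lik_le (T := T) (gaussianVec θ) fun y j => c y j - θ j
  have h1' : _ ≤ √R * √J := h1.trans (mul_le_mul (Real.sqrt_le_sqrt hR) (Real.sqrt_le_sqrt hJ)
    (Real.sqrt_nonneg _) (Real.sqrt_nonneg _))
  have h2' : _ ≤ √R * √(Fintype.card κ) := h2.trans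
    (mul_le_mul_of_nonneg_right (Real.sqrt_le_sqrt hR) (Real.sqrt_nonneg _))
  have h3 : ∑ y, ∑ j, bump a b (θ j) * T.lik (gaussianVec θ) y = ∑ j, bump a b (θ j) := by
    rw [Finset.sum_comm]
    simp_rw [← Finset.mul_sum, T.sum_lik, mul_one]
  have hba : 0 ≤ b - a := by linarith
  calc _ ≤ ∑ y, ∑ j, ((b - a) ^ 2 / 4 * (|c y j - θ j| *
          |T.score (gaussianVec θ) (fun z => varScore (θ j) (z j)) y|) +
          (b - a) * (|c y j - θ j| * T.lik (gaussianVec θ) y) -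
          bump a b (θ j) * T.lik (gaussianVec θ) y) := by
        refine Finset.sum_le_sum fun y _ => Finset.sum_le_sum fun j _ => ?_
        rw [(integral_testIntegrand ha hθ (c y j) j y).2]
        refine sub_le_sub_right ?_ _
        rw [mul_add]
        refine add_le_add ?_ ?_
        · refine (le_abs_self _).trans ?_
          rw [abs_mul, abs_mul, abs_of_nonneg (bump_nonneg (hθ j)), mul_left_comm]
          exact mul_le_mul_of_nonneg_right bump_le (by positivity)
        · refine (le_abs_self _).trans ?_
          rw [abs_mul, abs_mul, abs_of_nonneg (T.lik_nonneg _ y), mul_left_comm]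
          exact mul_le_mul_of_nonneg_right (abs_bump_deriv_le (hθ j))
            (mul_nonneg (abs_nonneg _) (T.lik_nonneg _ y))
    _ = (b - a) ^ 2 / 4 * ∑ y, ∑ j, |c y j - θ j| *
          |T.score (gaussianVec θ) (fun z => varScore (θ j) (z j)) y| +
          (b - a) * ∑ y, ∑ j, |c y j - θ j| * T.lik (gaussianVec θ) y -
          ∑ j, bump a b (θ j) := by
        rw [← h3]
        simp_rw [Finset.sum_sub_distrib, Finset.sum_add_distrib, ← Finset.mul_sum]
    _ ≤ (b - a) ^ 2 / 4 * (√R * √J) + (b - a) * (√R * √(Fintype.card κ)) -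
          ∑ j, bump a b (θ j) := by gcongr
    _ = _ := by ring

/-- A van Trees type inequality for the uniform prior on the cube `[a, b] ^ κ`. -/
theorem card_mul_le_of_risk_le (ha : 0 < a) (hab : a < b) (c : Y → κ → ℝ) {R J : ℝ}
    (hR : ∀ θ : κ → ℝ, (∀ j, θ j ∈ Set.Icc a b) →
      ∑ y, T.lik (gaussianVec θ) y * ∑ j, (c y j - θ j) ^ 2 ≤ R)
    (hJ : ∀ θ : κ → ℝ, (∀ j, θ j ∈ Set.Icc a b) →
      ∑ j, ∑ y, T.score (gaussianVec θ) (fun z => varScore (θ j) (z j)) y ^ 2 /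
        T.lik (gaussianVec θ) y ≤ J) :
    Fintype.card κ * ((b - a) ^ 2 / 6) ≤
      √R * ((b - a) ^ 2 / 4 * √J + (b - a) * √(Fintype.card κ)) := by
  have := isProbabilityMeasure_unifIcc hab
  set M := √R * ((b - a) ^ 2 / 4 * √J + (b - a) * √(Fintype.card κ))
  have hi (y : Y) (j : κ) : Integrable (fun θ => ∫ x, testIntegrand T a b (c y j) j y θ x)
      (Measure.pi fun _ : κ => unifIcc a b) :=
    (integrable_testIntegrand_prod ha hab (c y j) j y).integral_prod_left
  have hb (j : κ) : Integrable (fun θ : κ → ℝ => bump a b (θ j))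
      (Measure.pi fun _ : κ => unifIcc a b) := by
    refine Integrable.of_bound (C := (b - a) ^ 2 / 4) ?_ ((ae_prior a b hab).mono fun θ hθ => ?_)
    · unfold bump; exact Measurable.aestronglyMeasurable (by fun_prop)
    · rw [Real.norm_of_nonneg (bump_nonneg (hθ j))]
      exact bump_le
  have hs := integrable_finsetSum Finset.univ fun j (_ : j ∈ Finset.univ) => hb j
  have h0 : ∫ θ, (∑ y, ∑ j, ∫ x, testIntegrand T a b (c y j) j y θ x)
      ∂(Measure.pi fun _ : κ => unifIcc a b) = 0 := by
    rw [integral_finsetSum _ fun y _ => integrable_finsetSum _ fun j _ => hi y j]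
    refine Finset.sum_eq_zero fun y _ => ?_
    rw [integral_finsetSum _ fun j _ => hi y j]
    exact Finset.sum_eq_zero fun j _ => integral_integral_testIntegrand ha hab _ j y
  -- The left side averages to `0` over the prior, so the mean of the weight is at most the
  -- Cauchy–Schwarz bound.
  have h1 := integral_mono_ae
    (integrable_finsetSum _ fun y _ => integrable_finsetSum _ fun j _ => hi y j)
    ((integrable_const M).sub hs) ((ae_prior a b hab).mono fun θ hθ =>
      sum_sum_integral_testIntegrand_le ha hab hθ c (hR θ hθ) (hJ θ hθ))
  have h2 : ∫ θ : κ → ℝ, ∑ j, bump a b (θ j) ∂(Measure.pi fun _ : κ => unifIcc a b) =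
      Fintype.card κ * ((b - a) ^ 2 / 6) := by
    rw [integral_finsetSum _ fun j _ => hb j]
    have h (j : κ) : ∫ θ : κ → ℝ, bump a b (θ j) ∂(Measure.pi fun _ : κ => unifIcc a b) =
        (b - a) ^ 2 / 6 := by
      rw [integral_comp_eval (μ := fun _ : κ => unifIcc a b) (f := bump a b)
        (Measurable.aestronglyMeasurable (by unfold bump; fun_prop)), integral_bump hab]
    simp [h]
  rw [integral_sub' (integrable_const M) hs, h2] at h1
  refine sub_nonneg.1 ?_
  simpa [h0] using h1

end VanTrees

/-! ### The minimax lower bound -/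

lemma likelihood_gaussianDiag {d n : ℕ} {Y : Type*} [Fintype Y] {K : ℝ}
    (T : ProductTranscript (Fin n) Y (EuclideanSpace ℝ (Fin d)) K)
    (θ : EuclideanSpace ℝ (Fin d)) (hθ : ∀ i, 0 ≤ θ i) (y : Y) :
    likelihood (gaussianDiag θ) (fun x y => ∏ i, T.f i y (x i)) y =
      (T.comap (WithLp.toLp 2 : (Fin d → ℝ) → _) (by fun_prop)).lik (gaussianVec θ) y := by
  have hm : Measurable (WithLp.toLp 2 : (Fin d → ℝ) → EuclideanSpace ℝ (Fin d)) := by fun_prop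
  have : IsProbabilityMeasure (gaussianDiag θ) := by
    rw [gaussianDiag_eq_map θ hθ]
    exact Measure.isProbabilityMeasure_map hm.aemeasurable
  unfold likelihood
  rw [integral_fintype_prod_eq_prod (μ := fun _ : Fin n => gaussianDiag θ) (fun i => T.f i y)]
  refine Finset.prod_congr rfl fun i _ => ?_
  rw [gaussianDiag_eq_map θ hθ,
    integral_map hm.aemeasurable (T.measurable_f i y).aestronglyMeasurable]
  rfl

/-- The lower bound of the minimax risk for transcripts which factorize over the nodes. -/
theorem covarianceRate_le_worstCaseRisk {n k d : ℕ} {σmin σmax : ℝ}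
    {Θ : Set (EuclideanSpace ℝ (Fin d))} (hmin : 0 < σmin) (hmax : σmin < σmax)
    (hΘ : {θ : EuclideanSpace ℝ (Fin d) | ∀ i, θ i ∈ Set.Icc (σmin ^ 2) (σmax ^ 2)} ⊆ Θ)
    (hcond : (d : ℝ) * σmin ^ 4 ≤
      (n : ℝ) * (σmax ^ 2 - σmin ^ 2) ^ 2 * min ((k : ℝ) ^ 2) (d : ℝ))
    {Y : Type*} [Fintype Y] (T : ProductTranscript (Fin n) Y (EuclideanSpace ℝ (Fin d)) (2 ^ k))
    (θhat : Y → EuclideanSpace ℝ (Fin d)) :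
    ENNReal.ofReal (1 / 400 * covarianceRate n k d σmin) ≤
      worstCaseRisk Θ (fun x y => ∏ i, T.f i y (x i)) θhat := by
  rcases Nat.eq_zero_or_pos d with hd | hd
  · subst hd; simp [covarianceRate]
  by_contra! hlt
  have hd' : (1 : ℝ) ≤ d := by exact_mod_cast hd
  set a := σmin ^ 2 with ha_def
  set b := σmax ^ 2
  have ha : 0 < a := by positivity
  have hab : a < b := pow_lt_pow_left₀ hmax hmin.le two_ne_zero
  have ha2 : σmin ^ 4 = a ^ 2 := by rw [ha_def]; ring
  set m := min ((k : ℝ) ^ 2) (d : ℝ)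
  -- For `d ≥ 1` the assumed inequality already excludes `n = 0` and `k = 0`.
  have hpos : 0 < (n : ℝ) * (b - a) ^ 2 * m :=
    lt_of_lt_of_le (by positivity) hcond
  have hm0 : 0 ≤ m := le_min (by positivity) (by positivity)
  have hm : 0 < m := by
    rcases hm0.eq_or_lt with h | h
    · rw [← h] at hpos; simp at hpos
    · exact h
  have hn : 0 < (n : ℝ) := by
    rcases (Nat.cast_nonneg n : (0 : ℝ) ≤ n).eq_or_lt with h | h
    · rw [← h] at hpos; simp at hpos
    · exact h
  have hk : 1 ≤ k := by
    rcases Nat.eq_zero_or_pos k with h | h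
    · have := hm.trans_le (min_le_left _ _)
      simp [h] at this
    · exact h
  have hk' : (0 : ℝ) < k := by exact_mod_cast hk
  -- The maximum in the rate is the minimum in the information bound, inverted.
  have hrate : covarianceRate n k d σmin = a ^ 2 * (d ^ 2 / (n * m)) := by
    rw [covarianceRate, ha2]
    congr 1
    rcases le_total ((k : ℝ) ^ 2) d with h | h
    · rw [show m = (k : ℝ) ^ 2 from min_eq_left h]
      refine max_eq_left ?_
      rw [div_le_div_iff₀ hn (by positivity)]
      nlinarith [mul_le_mul_of_nonneg_left h (by positivity : (0 : ℝ) ≤ d * n)]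
    · rw [show m = (d : ℝ) from min_eq_right h]
      rw [max_eq_right]
      · field_simp
      · rw [div_le_div_iff₀ (by positivity) hn]
        nlinarith [mul_le_mul_of_nonneg_left h (by positivity : (0 : ℝ) ≤ d * n)]
  set R := 1 / 400 * covarianceRate n k d σmin with hR_def
  set T' := T.comap (WithLp.toLp 2 : (Fin d → ℝ) → EuclideanSpace ℝ (Fin d)) (by fun_prop)
  have hR (θ : Fin d → ℝ) (hθ : ∀ j, θ j ∈ Set.Icc a b) :
      ∑ y, T'.lik (gaussianVec θ) y * ∑ j, (θhat y j - θ j) ^ 2 ≤ R := by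
    have hmem : WithLp.toLp 2 θ ∈ Θ := hΘ hθ
    have h1 : ENNReal.ofReal (risk (fun x y => ∏ i, T.f i y (x i)) θhat (WithLp.toLp 2 θ)) <
        ENNReal.ofReal R :=
      (le_iSup₂ (f := fun θ (_ : θ ∈ Θ) =>
        ENNReal.ofReal (risk (fun x y => ∏ i, T.f i y (x i)) θhat θ)) _ hmem).trans_lt hlt
    have h2 := (ENNReal.ofReal_lt_ofReal_iff'.1 h1).1
    refine le_trans (le_of_eq ?_) h2.le
    unfold risk
    refine Finset.sum_congr rfl fun y _ => ?_
    rw [likelihood_gaussianDiag T _ fun i => ha.le.trans (hθ i).1, EuclideanSpace.real_norm_sq_eq]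
    rfl
  have hJ (θ : Fin d → ℝ) (hθ : ∀ j, θ j ∈ Set.Icc a b) :
      ∑ j, ∑ y, T'.score (gaussianVec θ) (fun z => varScore (θ j) (z j)) y ^ 2 /
        T'.lik (gaussianVec θ) y ≤ 8 ^ 2 * (n * m / a ^ 2) := by
    have h := T'.fisher_trace_le hk rfl (isSubexpScore_gaussianVec ha fun j => (hθ j).1)
      (by positivity)
    refine h.trans (le_of_eq ?_)
    simp only [Fintype.card_fin]
    change 16 / (a / 2) ^ 2 * (n * m) = _
    field_simp
    norm_num
  have key := card_mul_le_of_risk_le ha hab (fun y j => θhat y j) hR hJ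
  rw [Fintype.card_fin] at key
  set I := n * m / a ^ 2 with hI_def
  have hI : 0 < I := by positivity
  have hba : 0 < b - a := sub_pos.2 hab
  have h8 : √(8 ^ 2 * I) = 8 * √I := by
    rw [Real.sqrt_mul (by positivity), Real.sqrt_sq (by norm_num)]
  -- The only quantitative use of `hcond`: the cube is wide enough for the prior term to be
  -- dominated by the information term.
  have hdI : √(d : ℝ) ≤ (b - a) * √I := by
    rw [← Real.sqrt_sq hba.le, ← Real.sqrt_mul (by positivity)]
    refine Real.sqrt_le_sqrt ?_
    rw [hI_def, mul_div_assoc', le_div_iff₀ (by positivity), ← ha2]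
    linarith
  rw [h8] at key
  -- The constant is `3 = 8 / 4 + 1`: information term plus prior term.
  have h1 : d * ((b - a) ^ 2 / 6) ≤ √R * (3 * (b - a) ^ 2 * √I) := by
    refine key.trans (mul_le_mul_of_nonneg_left ?_ (Real.sqrt_nonneg _))
    nlinarith [mul_le_mul_of_nonneg_left hdI hba.le]
  have h2 : (d : ℝ) ≤ 18 * (√R * √I) := by
    have : (b - a) ^ 2 * d ≤ (b - a) ^ 2 * (18 * (√R * √I)) := by linarith
    exact le_of_mul_le_mul_left this (by positivity)
  have hR0 : 0 ≤ R := by rw [hR_def, hrate]; positivity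
  have h3 : (d : ℝ) ^ 2 ≤ 324 * (R * I) := by
    refine (pow_le_pow_left₀ (by positivity) h2 2).trans (le_of_eq ?_)
    rw [mul_pow, mul_pow, Real.sq_sqrt hR0, Real.sq_sqrt hI.le]
    norm_num
  have h4 : R * I = 1 / 400 * d ^ 2 := by
    rw [hR_def, hrate, hI_def]
    field_simp
  -- Now `d ^ 2 ≤ (324 / 400) * d ^ 2`, which is absurd for `d ≥ 1`; any constant below `1 / 324`
  -- would serve.
  rw [h4] at h3
  nlinarith

end DistributedEstimation

end

theorem mainTheorem7 :
    ∃ C : ℝ, 0 < C ∧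
      ∀ (n k d : ℕ) (σmin σmax : ℝ) (Θ : Set (EuclideanSpace ℝ (Fin d))),
        0 < σmin → σmin < σmax →
        (∀ θ ∈ Θ, ∀ i, 0 ≤ θ i) →
        {θ : EuclideanSpace ℝ (Fin d) | ∀ i, θ i ∈ Set.Icc (σmin ^ 2) (σmax ^ 2)} ⊆ Θ →
        (d : ℝ) * σmin ^ 4 ≤
          (n : ℝ) * (σmax ^ 2 - σmin ^ 2) ^ 2 * min ((k : ℝ) ^ 2) (d : ℝ) →
        (∀ (P : DistributedEstimation.IndependentProtocol (EuclideanSpace ℝ (Fin d)) n k)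
            (θhat : (Fin n → Fin (2 ^ k)) → EuclideanSpace ℝ (Fin d)),
          ENNReal.ofReal (C * DistributedEstimation.covarianceRate n k d σmin) ≤
            DistributedEstimation.worstCaseRisk Θ P.transcriptProb θhat) ∧
        (∀ (P : DistributedEstimation.SequentialProtocol (EuclideanSpace ℝ (Fin d)) n k)
            (θhat : (Fin n → Fin (2 ^ k)) → EuclideanSpace ℝ (Fin d)),
          ENNReal.ofReal (C * DistributedEstimation.covarianceRate n k d σmin) ≤
            DistributedEstimation.worstCaseRisk Θ P.transcriptProb θhat) ∧
        (∀ (P : DistributedEstimation.BlackboardProtocol (EuclideanSpace ℝ (Fin d)) n k)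
            (θhat : (Fin (n * k) → Bool) → EuclideanSpace ℝ (Fin d)),
          ENNReal.ofReal (C * DistributedEstimation.covarianceRate n k d σmin) ≤
            DistributedEstimation.worstCaseRisk Θ P.transcriptProb θhat) := by
  refine ⟨1 / 400, by norm_num, fun n k d σmin σmax Θ hmin hmax _ hΘ hcond => ⟨?_, ?_, ?_⟩⟩
  · intro P θhat
    obtain ⟨T, hT⟩ := P.exists_productTranscript
    rw [hT]
    exact DistributedEstimation.covarianceRate_le_worstCaseRisk hmin hmax hΘ hcond T θhat
  · intro P θhat
    obtain ⟨T, hT⟩ := P.exists_productTranscript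
    rw [hT]
    exact DistributedEstimation.covarianceRate_le_worstCaseRisk hmin hmax hΘ hcond T θhat
  · intro P θhat
    obtain ⟨T, hT⟩ := P.exists_productTranscript
    rw [hT]
    exact DistributedEstimation.covarianceRate_le_worstCaseRisk hmin hmax hΘ hcond T θhat
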